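/- Let $P$ be a probability measure on a measurable space $\Xi$, let $f:\mathbb{R}^d\times\Xi\to\mathbb{R}$ be measurable with $f(x,\cdot)$ $P$-integrable for every $x$, and let $F(x)=\int_\Xi f(x,\xi)\,dP(\xi)$. Assume: 1. $F$ is continuously differentiable and $\nabla F$ is Lipschitz continuous with constant $L>0$; 2. $F$ (not necessarily convex) is twice differentiable and bounded below, and the derivative of $x\mapsto\|\nabla F(x)\|_2^2$ is Lipschitz continuous; 3. $Q$ is a probability measure on $\mathbb{R}^d$ such that, for $\zeta\sim Q$, $\mathbb{E}[\zeta^{(i)}]=0$ and $\mathbb{E}[\zeta^{(i)}\zeta^{(j)}]=\delta_{ij}$ for all $i,j$, and each component $\zeta^{(i)}$ is almost surely bounded or has a finite fourth moment. Let $n_k,q_k\ge 1$ be integers, and let $\xi_{k,i,j}\sim P$ and $\zeta_{k,i}\sim Q$ ($1\le i\le n_k$, $1\le j\le q_k$) be jointly independent random variables; write $\xi_k=(\xi_{k,i,j})_{i,j}$ and $\zeta_k=(\zeta_{k,i})_i$. For $\alpha>0$ define the gradient-free stochastic step $$s(x,\xi_k,\alpha,\zeta_k)=\frac1{n_k}\sum_{i=1}^{n_k}\Big[\frac1{q_k}\sum_{j=1}^{q_k}\big(f(x,\xi_{k,i,j})-f(x+\alpha\zeta_{k,i},\xi_{k,i,j})\big)\Big]\zeta_{k,i}$$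 (the cases $n_k=1$ and/or $q_k=1$ give the basic step and the other mini-batch variants). Let $\alpha_k=\frac{\beta}{k+\sigma}$ with $\beta,\sigma>0$, and let the decay factor be either $\gamma(k)=\big(\frac{k}{k+1}\big)^p$ for some $p>0$, or a constant $\gamma(k)=\gamma\in(0,1)$. From a deterministic initial point $x_1$, generate for $k=1,2,\dots$ $$x_{k+1}=x_k+\alpha_k m_k,\qquad m_k=\frac{1}{\sum_{i=1}^k\prod_{l=i}^k\gamma(l)}\sum_{j=1}^k\Big(\prod_{l=j}^k\gamma(l)\Big)\frac{s(x_j,\xi_j,\alpha_j,\zeta_j)}{\alpha_j}.$$ Assume moreover that there are $M,M_V\ge 0$ such that for every $k\ge1$, almost surely, $s(x_k,\xi_k,\alpha_k,\zeta_k)$ has a finite second moment with respect to $(\xi_k,\zeta_k)$ and $$\mathbb{E}_{\xi_k,\zeta_k}\big[\|s(x_k,\xi_k,\alpha_k,\zeta_k)\|_2^2\big]-\big\|\mathbb{E}_{\xi_k,\zeta_k}[s(x_k,\xi_k,\alpha_k,\zeta_k)]\big\|_2^2\le\alpha_k^2M+\alpha_k^2M_V\|\nabla F(x_k)\|_2^2,$$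 where $\mathbb{E}_{\xi_k,\zeta_k}$ is the expectation over $(\xi_k,\zeta_k)$ with $x_k$ held fixed. Then $\mathbb{E}\big[\|\nabla F(x_k)\|_2^2\big]<\infty$ for every $k\ge1$ and $$\lim_{k\to\infty}\mathbb{E}\big[\|\nabla F(x_k)\|_2^2\big]=0.$$ -/

import Mathlib

open MeasureTheory ProbabilityTheory Filter Topology

namespace SGFD

/-- `ℝ^d` with the Euclidean norm. -/
abbrev Vec (d : ℕ) : Type := EuclideanSpace ℝ (Fin d)

/-- The objective `F(x) = E_ξ[f(x, ξ)] = ∫ f(x, ξ) dP(ξ)`. -/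
noncomputable def objective {Ξ : Type*} [MeasurableSpace Ξ] {d : ℕ}
    (P : Measure Ξ) (f : Vec d → Ξ → ℝ) (x : Vec d) : ℝ :=
  ∫ z, f x z ∂P

/-- `F` is continuously differentiable and `∇F` is Lipschitz with constant `L`. -/
structure HasLipschitzGradient {d : ℕ} (F : Vec d → ℝ) (L : ℝ) : Prop where
  contDiff : ContDiff ℝ 1 F
  lipschitz : ∀ x y : Vec d, ‖gradient F y - gradient F x‖ ≤ L * ‖y - x‖

/-- General (possibly nonconvex) objectives: `F` is twice differentiable and bounded below, and
the derivative of `x ↦ ‖∇F(x)‖²` is Lipschitz. -/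
structure IsGeneralObjective {d : ℕ} (F : Vec d → ℝ) : Prop where
  differentiable : Differentiable ℝ F
  differentiable_gradient : Differentiable ℝ (gradient F)
  bddBelow : ∃ Finf : ℝ, ∀ x, Finf ≤ F x
  lipschitz_gradient_sq : ∃ LG : ℝ, 0 < LG ∧ ∀ x y : Vec d,
    ‖gradient (fun z => ‖gradient F z‖ ^ 2) y - gradient (fun z => ‖gradient F z‖ ^ 2) x‖
      ≤ LG * ‖y - x‖

/-- The conditions on the law `Q` of a random direction: centred components, identity covariance
matrix, and every component is bounded or has a finite fourth moment. -/
structure IsDirectionLaw {d : ℕ} (Q : Measure (Vec d)) : Prop where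
  mean : ∀ i, ∫ u : Vec d, u i ∂Q = 0
  cov : ∀ i j, ∫ u : Vec d, u i * u j ∂Q = if i = j then 1 else 0
  bounded_or_fourth : ∃ r m4 : ℝ, ∀ i,
    (∀ᵐ u : Vec d ∂Q, |u i| ≤ r) ∨
      (Integrable (fun u : Vec d => u i ^ 4) Q ∧ ∫ u : Vec d, u i ^ 4 ∂Q ≤ m4)

/-- The samples `ξ k i j` have law `P`, the directions `ζ k i` have law `Q`, and all of them are
jointly independent.  In iteration `k` there are `n k` directions, each evaluated on `m k`
samples. -/
structure IsSampling {Ω Ξ : Type*} [MeasurableSpace Ω] [MeasurableSpace Ξ] {d : ℕ}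
    (μ : Measure Ω) (P : Measure Ξ) (Q : Measure (Vec d)) (n m : ℕ → ℕ)
    (ξ : (k : ℕ) → Fin (n k) → Fin (m k) → Ω → Ξ)
    (ζ : (k : ℕ) → Fin (n k) → Ω → Vec d) : Prop where
  measurable_sample : ∀ k i j, Measurable (ξ k i j)
  measurable_direction : ∀ k i, Measurable (ζ k i)
  law_sample : ∀ k i j, μ.map (ξ k i j) = P
  law_direction : ∀ k i, μ.map (ζ k i) = Q
  indep_sample :
    iIndepFun (fun q : (k : ℕ) × (Fin (n k) × Fin (m k)) => ξ q.1 q.2.1 q.2.2) μ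
  indep_direction : iIndepFun (fun q : (k : ℕ) × Fin (n k) => ζ q.1 q.2) μ
  indep : IndepFun (fun ω k i j => ξ k i j ω) (fun ω k i => ζ k i ω) μ

/-- The gradient-free stochastic step with stepsize `a`, directions `u i` and samples `z i j`:
`(1/n) ∑ᵢ [(1/m) ∑ⱼ (f(x, zᵢⱼ) - f(x + a uᵢ, zᵢⱼ))] uᵢ`.
`n = m = 1` is the basic step `(f(x, z) - f(x + a u, z)) u`; `n = 1` is a mini-batch of samples
with a common direction; `m = 1` is a mini-batch with one sample for each direction; and an `f`
that does not depend on the sample gives the steps that evaluate the objective itself. -/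
noncomputable def step {Ξ : Type*} {d : ℕ} (f : Vec d → Ξ → ℝ) (a : ℝ) (x : Vec d)
    {n m : ℕ} (z : Fin n → Fin m → Ξ) (u : Fin n → Vec d) : Vec d :=
  (n : ℝ)⁻¹ • ∑ i, ((m : ℝ)⁻¹ * ∑ j, (f x (z i j) - f (x + a • u i) (z i j))) • u i

/-- The stepsizes `α_k = β / (k + σ)`, used for `k ≥ 1`. -/
noncomputable def stepsize (β σ : ℝ) (k : ℕ) : ℝ := β / ((k : ℝ) + σ)

/-- The decay factor is either the changing one, `γ(k) = (k / (k + 1)) ^ p` with `p > 0`, or a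
fixed scalar in `(0, 1)`. -/
def IsDecayFactor (γ : ℕ → ℝ) : Prop :=
  (∃ p : ℝ, 0 < p ∧ ∀ k : ℕ, 1 ≤ k → γ k = ((k : ℝ) / ((k : ℝ) + 1)) ^ p) ∨
    (∃ c : ℝ, 0 < c ∧ c < 1 ∧ ∀ k : ℕ, 1 ≤ k → γ k = c)

/-- The weight `∏_{l=j}^k γ(l)`; it is `j^p / (k + 1)^p` for `γ(k) = (k / (k + 1)) ^ p`. -/
noncomputable def weight (γ : ℕ → ℝ) (k j : ℕ) : ℝ := ∏ l ∈ Finset.Icc j k, γ l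

/-- The weighted average direction
`m_k = (∑_{i=1}^k ∏_{l=i}^k γ(l))⁻¹ ∑_{j=1}^k (∏_{l=j}^k γ(l)) s_j / α_j`
formed from the steps `s_1, …, s_k`. -/
noncomputable def momentum {d : ℕ} (γ α : ℕ → ℝ) (s : ℕ → Vec d) (k : ℕ) : Vec d :=
  (∑ i ∈ Finset.Icc 1 k, weight γ k i)⁻¹ •
    ∑ j ∈ Finset.Icc 1 k, (weight γ k j / α j) • s j

/-- `X 1, X 2, …` are the iterates of the accelerated method started at `x₁`:
`x_{k+1} = x_k + α_k m_k`, where `s_j = s(x_j, ξ_j, α_j, ζ_j)`.  The value `X 0` is not used. -/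
structure IsMomentumMethod {Ω Ξ : Type*} {d : ℕ} (f : Vec d → Ξ → ℝ) (γ α : ℕ → ℝ)
    {n m : ℕ → ℕ} (ξ : (k : ℕ) → Fin (n k) → Fin (m k) → Ω → Ξ)
    (ζ : (k : ℕ) → Fin (n k) → Ω → Vec d) (x₁ : Vec d) (X : ℕ → Ω → Vec d) : Prop where
  start : ∀ ω, X 1 ω = x₁
  next : ∀ k, 1 ≤ k → ∀ ω, X (k + 1) ω = X k ω + α k •
    momentum γ α
      (fun j => step f (α j) (X j ω) (fun i i' => ξ j i i' ω) (fun i => ζ j i ω)) k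

/-- The variance condition along the iterates:
`V_{ξ_k, ζ_k}[s(x_k, ξ_k, α_k, ζ_k)] ≤ α_k² M + α_k² M_V ‖∇F(x_k)‖²`, where
`V[s] = E‖s‖² - ‖E s‖²` and the expectations are over the fresh seeds `(ξ_k, ζ_k)` with the value
`x_k = X k ω` held fixed.  Finiteness of the second moment is part of the condition. -/
def HasStepVarianceBound {Ω Ξ : Type*} [MeasurableSpace Ω] [MeasurableSpace Ξ] {d : ℕ}
    (μ : Measure Ω) (P : Measure Ξ) (f : Vec d → Ξ → ℝ) (α : ℕ → ℝ) {n m : ℕ → ℕ}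
    (ξ : (k : ℕ) → Fin (n k) → Fin (m k) → Ω → Ξ)
    (ζ : (k : ℕ) → Fin (n k) → Ω → Vec d) (X : ℕ → Ω → Vec d) (M MV : ℝ) : Prop :=
  ∀ k, 1 ≤ k → ∀ᵐ ω ∂μ,
    MemLp (fun ω' => step f (α k) (X k ω) (fun i j => ξ k i j ω') (fun i => ζ k i ω')) 2 μ ∧
    (∫ ω', ‖step f (α k) (X k ω) (fun i j => ξ k i j ω') (fun i => ζ k i ω')‖ ^ 2 ∂μ)
        - ‖∫ ω', step f (α k) (X k ω) (fun i j => ξ k i j ω') (fun i => ζ k i ω') ∂μ‖ ^ 2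
      ≤ α k ^ 2 * M + α k ^ 2 * MV * ‖gradient (objective P f) (X k ω)‖ ^ 2

end SGFD

/-! The weighted average obeys `m_{k+1} = (1 - θ) m_k + θ s_{k+1} / α_{k+1}`, where `θ` is the
normalized weight of the newest step. Given the past, the scaled step estimates `-∇F` with bias
`O(α)`: the first-order term of `F(x) - F(x + αζ)`, multiplied by `ζ`, averages to `-α ∇F(x)` by the
identity covariance, and the remainder costs a third moment of `ζ`. Its second moment is at most `A
+ B ‖∇F‖²`. Taking expectations leaves the scalar inequalities of `MomentRecursion`, which link the
gap `Φ`, the squared gradient `G`, the correlation `R` of gradient and momentum, and the squared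
momentum `N`.

The correlation `R` has no sign, so `Φ` alone need not decrease. A Lyapunov function, `Φ` plus
multiples of `R` and `N`, cancels `R` up to `O(α²)` and decreases by a multiple of `α G`. For
constant decay `θ` stays away from zero and the momentum forgets quickly (`tendsto_of_weight_ge`).
For polynomial decay `θ` is asymptotically proportional to `α` and the system behaves like a heavy
ball with friction (`tendsto_of_weight_equiv`).

Since `∑ α² < ∞`, this gives `∑ α G < ∞` and boundedness of `G` and `N`. Then `G` increases by at
most `O(α)` per step, and `∑ α = ∞` forces `G → 0` (`tendsto_zero_of_summable_mul`). -/

namespace SGFD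

/-! ### Real sequences with summable errors -/

/-- A nonnegative sequence that decreases up to summable errors is bounded, and its decrements
are summable. -/
theorem summable_of_descent {V g e : ℕ → ℝ} (hV : ∀ k, 0 ≤ V k) (hg : ∀ k, 0 ≤ g k)
    (he : ∀ k, 0 ≤ e k) (hes : Summable e) (h : ∀ k, V (k + 1) ≤ V k - g k + e k) :
    (∃ b, ∀ k, V k ≤ b) ∧ Summable g := by
  have key : ∀ k, V k + ∑ i ∈ Finset.range k, g i ≤ V 0 + ∑ i ∈ Finset.range k, e i := by
    intro k
    induction k with
    | zero => simp
    | succ k ih =>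
      rw [Finset.sum_range_succ, Finset.sum_range_succ]
      linarith [h k]
  have hle : ∀ k, ∑ i ∈ Finset.range k, e i ≤ ∑' i, e i := fun k =>
    hes.sum_le_tsum _ fun i _ => he i
  refine ⟨⟨V 0 + ∑' i, e i, fun k => ?_⟩, ?_⟩
  · have := Finset.sum_nonneg fun i (_ : i ∈ Finset.range k) => hg i
    linarith [key k, hle k]
  · refine summable_of_sum_range_le (c := V 0 + ∑' i, e i) hg fun k => ?_
    linarith [key k, hle k, hV k]

/-- A sequence bounded below that increases only by summable amounts converges. -/
theorem exists_tendsto_of_le_add_summable {w e : ℕ → ℝ} (hw : ∀ k, 0 ≤ w k)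
    (he : ∀ k, 0 ≤ e k) (hes : Summable e) (h : ∀ k, w (k + 1) ≤ w k + e k) :
    ∃ l, Tendsto w atTop (𝓝 l) := by
  have hanti : Antitone fun k => w k - ∑ i ∈ Finset.range k, e i := by
    refine antitone_nat_of_succ_le fun k => ?_
    rw [Finset.sum_range_succ]
    linarith [h k]
  have hbdd : BddBelow (Set.range fun k => w k - ∑ i ∈ Finset.range k, e i) := by
    refine ⟨-∑' i, e i, ?_⟩
    rintro _ ⟨k, rfl⟩
    have := hes.sum_le_tsum (Finset.range k) fun i _ => he i
    dsimp only
    linarith [hw k]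
  have h1 := (tendsto_atTop_ciInf hanti hbdd).add hes.hasSum.tendsto_sum_nat
  exact ⟨_, h1.congr fun k => by ring⟩

/-- If `∑ α_k u_k < ∞` while `∑ α_k = ∞` and `u` increases by at most `O(α_k)` in step `k`, then
`u` tends to zero. -/
theorem tendsto_zero_of_summable_mul {α u : ℕ → ℝ} {C : ℝ} (hC : 0 ≤ C) (hα : ∀ k, 0 ≤ α k)
    (hu : ∀ k, 0 ≤ u k) (hα2 : Summable fun k => α k ^ 2) (hα1 : ¬ Summable α)
    (hαu : Summable fun k => α k * u k) (h : ∀ k, u (k + 1) ≤ u k + C * α k) :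
    Tendsto u atTop (𝓝 0) := by
  -- The increments `C α` of `u` are not summable, but those of `u²`, namely `2 C α u + C² α²`, are.
  obtain ⟨l, hl⟩ : ∃ l, Tendsto (fun k => u k ^ 2) atTop (𝓝 l) := by
    refine exists_tendsto_of_le_add_summable (e := fun k => 2 * C * (α k * u k) + C ^ 2 * α k ^ 2)
      (fun k => sq_nonneg _) (fun k => ?_) ((hαu.mul_left _).add (hα2.mul_left _)) fun k => ?_
    · have := hα k
      have := hu k
      positivity
    · calc u (k + 1) ^ 2 ≤ (u k + C * α k) ^ 2 := pow_le_pow_left₀ (hu _) (h k) 2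
        _ = _ := by ring
  have hl' : Tendsto u atTop (𝓝 (√l)) := by
    refine ((Real.continuous_sqrt.tendsto l).comp hl).congr fun k => ?_
    exact Real.sqrt_sq (hu k)
  rcases (Real.sqrt_nonneg l).eq_or_lt with h0 | h0
  · rwa [← h0] at hl'
  · exfalso
    apply hα1
    have hev : ∀ᶠ k in atTop, √l / 2 ≤ u k := hl'.eventually_const_le (by linarith)
    have := hαu.mul_left (2 / √l)
    refine Summable.of_norm_bounded_eventually_nat this ?_
    filter_upwards [hev] with k hk
    rw [Real.norm_of_nonneg (hα k)]
    calc α k = 2 / √l * (α k * (√l / 2)) := by field_simp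
      _ ≤ _ := by
        have := hα k
        gcongr

/-! ### Moment recursion and Lyapunov functions -/

/-- The inequalities that link the moments of a momentum method: `Φ` is the expected gap
`E F(x_k) - inf F`, `G = E‖∇F(x_k)‖²`, `R = E⟪∇F(x_k), m_{k-1}⟫`, `N = E‖m_{k-1}‖²` and
`P = E⟪∇F(x_k), m_k⟫`, where `m_k = (1 - θ_k) m_{k-1} + θ_k g_k` and `x_{k+1} = x_k + α_k m_k`. -/
structure MomentRecursion (L C A B : ℝ) (α θ Φ G R N P : ℕ → ℝ) : Prop where
  grad_nonneg : ∀ k, 0 ≤ G k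
  mom_nonneg : ∀ k, 0 ≤ N k
  grad_le : ∀ k, G k ≤ 2 * L * Φ k
  cauchy : ∀ k t, 0 ≤ G k + 2 * t * R k + t ^ 2 * N k
  gap_succ : ∀ k, Φ (k + 1) ≤ Φ k + α k * P k + L / 2 * α k ^ 2 * N (k + 1)
  corr_succ : ∀ k, R (k + 1) ≤ P k + L * α k * N (k + 1)
  inner_le : ∀ k, P k ≤ (1 - θ k) * R k - θ k * G k + θ k * (C * α k * (1 + G k))
  mom_succ : ∀ k, N (k + 1) ≤ (1 - θ k) ^ 2 * N k
    + 2 * θ k * (1 - θ k) * (-R k + C * α k * (1 + N k)) + θ k ^ 2 * (A + B * G k)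
  mom_succ_convex : ∀ k, N (k + 1) ≤ (1 - θ k) * N k + θ k * (A + B * G k)
  grad_succ : ∀ k, G (k + 1) ≤ G k + L * α k * (G k + N (k + 1)) + L ^ 2 * α k ^ 2 * N (k + 1)

namespace MomentRecursion

variable {L C A B a₀ : ℝ} {α θ Φ G R N P : ℕ → ℝ}

theorem abs_corr_le (h : MomentRecursion L C A B α θ Φ G R N P) (k : ℕ) :
    |R k| ≤ (G k + N k) / 2 := by
  have h1 := h.cauchy k 1
  have h2 := h.cauchy k (-1)
  rw [abs_le]
  constructor <;> linarith

/-- This turns a Lyapunov function into convergence. The bound `V ≥ Φ / 2` makes boundedness of `V`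
control `Φ`, hence `G` through `G ≤ 2 L Φ`. The quantity `H` may exceed `G`, so that errors
containing `N` can be absorbed as well. -/
theorem tendsto_of_lyapunov (h : MomentRecursion L C A B α θ Φ G R N P) (hL : 0 < L)
    (hB : 0 ≤ B) (hα : ∀ k, 0 ≤ α k) (hα2 : Summable fun k => α k ^ 2)
    (hα1 : ¬ Summable α) (hθ0 : ∀ k, 0 ≤ θ k) (hθ1 : ∀ k, θ k ≤ 1)
    {V H : ℕ → ℝ} {c C' : ℝ} (hc : 0 < c) (hC' : 0 ≤ C') (hH : ∀ k, G k ≤ H k)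
    (hV : ∀ k, Φ k / 2 ≤ V k)
    (hdesc : ∀ k, V (k + 1) ≤ V k - c * α k * H k + C' * α k ^ 2 * (1 + H k)) :
    Tendsto G atTop (𝓝 0) := by
  have hH0 : ∀ k, 0 ≤ H k := fun k => (h.grad_nonneg k).trans (hH k)
  have hα0 : Tendsto α atTop (𝓝 0) := by
    have := (Real.continuous_sqrt.tendsto 0).comp hα2.tendsto_atTop_zero
    rw [Real.sqrt_zero] at this
    exact this.congr fun k => Real.sqrt_sq (hα k)
  -- From `K` on, half of the decrease absorbs the error `C' α² H`, and `α² ≤ α`.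
  obtain ⟨K, hK⟩ : ∃ K, ∀ k ≥ K, C' * α k ≤ c / 2 ∧ α k ≤ 1 := by
    have h1 : Tendsto (fun k => C' * α k) atTop (𝓝 0) := by simpa using hα0.const_mul C'
    exact eventually_atTop.mp ((h1.eventually_le_const (by positivity)).and
      (hα0.eventually_le_const one_pos))
  have hΦ : ∀ k, 0 ≤ Φ k := fun k =>
    nonneg_of_mul_nonneg_right ((h.grad_nonneg k).trans (h.grad_le k)) (by positivity)
  have hα2K : Summable fun k => α (k + K) ^ 2 := (summable_nat_add_iff K).mpr hα2
  obtain ⟨⟨b, hb⟩, hs⟩ := summable_of_descent (V := fun k => V (k + K))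
    (g := fun k => c / 2 * α (k + K) * G (k + K)) (e := fun k => C' * α (k + K) ^ 2)
    (fun k => by linarith [hV (k + K), hΦ (k + K)])
    (fun k => by
      have := hα (k + K)
      have := h.grad_nonneg (k + K)
      positivity) (fun k => by positivity)
    (hα2K.mul_left C') (fun k => by
      have h1 := hdesc (k + K)
      have h2 := (hK (k + K) (by omega)).1
      have h3 := mul_le_mul_of_nonneg_right h2 (mul_nonneg (hα (k + K)) (hH0 (k + K)))
      have h4 := mul_le_mul_of_nonneg_left (hH (k + K)) (mul_nonneg (half_pos hc).le (hα (k + K)))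
      rw [show k + 1 + K = k + K + 1 by ring]
      nlinarith)
  have hGb : ∀ k, G (k + K) ≤ 4 * L * b := fun k => by
    have h1 := h.grad_le (k + K)
    have h2 := hV (k + K)
    have h3 := mul_le_mul_of_nonneg_left (h2.trans (hb k)) (by positivity : 0 ≤ 4 * L)
    linarith
  have hb0 : 0 ≤ 4 * L * b := (h.grad_nonneg _).trans (hGb 0)
  obtain ⟨b', hb'⟩ : ∃ b', ∀ k, N (k + K) ≤ b' := by
    -- By `mom_succ_convex` the new `N` is at most a convex combination of the old one and a bounded
    -- quantity.
    refine ⟨max (N K) (A + B * (4 * L * b)), fun k => ?_⟩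
    induction k with
    | zero => simp
    | succ k ih =>
      have h1 := h.mom_succ_convex (k + K)
      have h2 : A + B * G (k + K) ≤ max (N K) (A + B * (4 * L * b)) :=
        le_trans (by gcongr; exact hGb k) (le_max_right _ _)
      have h3 := mul_le_mul_of_nonneg_left ih (sub_nonneg.mpr (hθ1 (k + K)))
      have h4 := mul_le_mul_of_nonneg_left h2 (hθ0 (k + K))
      rw [show k + 1 + K = k + K + 1 by ring]
      linarith
  have hb'0 : 0 ≤ b' := (h.mom_nonneg _).trans (hb' 0)
  rw [← tendsto_add_atTop_iff_nat K]
  refine tendsto_zero_of_summable_mul (α := fun k => α (k + K))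
    (C := L * (4 * L * b + b') + L ^ 2 * b') (by positivity) (fun k => hα _)
    (fun k => h.grad_nonneg _) hα2K ((summable_nat_add_iff K).not.mpr hα1)
    ((hs.mul_left (2 / c)).congr fun k => by field_simp) fun k => ?_
  have h1 := h.grad_succ (k + K)
  have h2 : N (k + K + 1) ≤ b' := by simpa [add_right_comm] using hb' (k + 1)
  have h3 := hα (k + K)
  have h4 : α (k + K) ^ 2 ≤ α (k + K) := by
    have := (hK (k + K) (by omega)).2
    nlinarith
  have h5 : L * α (k + K) * (G (k + K) + N (k + K + 1)) ≤ L * α (k + K) * (4 * L * b + b') := by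
    gcongr
    exact hGb k
  have h6 : L ^ 2 * α (k + K) ^ 2 * N (k + K + 1) ≤ L ^ 2 * α (k + K) * b' := by
    have := h.mom_nonneg (k + K + 1)
    gcongr
  rw [show k + 1 + K = k + K + 1 by ring]
  linarith

/-- Averaging weights that stay away from zero: the Lyapunov function is
`Φ + b R + κ α² N` with `b = O(α)`. -/
theorem tendsto_of_weight_ge (h : MomentRecursion L C A B α θ Φ G R N P) (hL : 0 < L)
    (hC : 0 ≤ C) (hA : 0 ≤ A) (hB : 0 ≤ B) (hα : ∀ k, 0 ≤ α k)
    (hα2 : Summable fun k => α k ^ 2) (hα1 : ¬ Summable α) (hanti : ∀ k, α (k + 1) ≤ α k)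
    {θ₀ lam C₁ : ℝ} {b : ℕ → ℝ} (hθ₀ : 0 < θ₀) (hθ : ∀ k, θ₀ ≤ θ k) (hθ1 : ∀ k, θ k ≤ 1)
    (hlam : 0 ≤ lam) (hC₁ : 0 ≤ C₁) (hb0 : ∀ k, 0 ≤ b k) (hb : ∀ k, b k ≤ lam * α k)
    (hb1 : ∀ k, b (k + 1) ≤ lam * α k)
    (he : ∀ k, |(α k + b (k + 1)) * (1 - θ k) - b k| ≤ C₁ * α k ^ 2) :
    Tendsto G atTop (𝓝 0) := by
  set K₀ := L / 2 + L * lam with hK₀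
  -- `κ` is large enough for its contraction `κ θ₀` to absorb the `N` terms of order `α²` that come
  -- from `Φ` and `R`, and for `L b² ≤ κ α²`, which keeps `V ≥ Φ / 2`.
  set κ := (C₁ / 2 + K₀ + L * lam ^ 2) / θ₀ with hκ
  have hκ0 : 0 ≤ κ := by positivity
  have hκθ : κ * θ₀ = C₁ / 2 + K₀ + L * lam ^ 2 := by rw [hκ]; field_simp
  have hθ₀1 : θ₀ ≤ 1 := (hθ 0).trans (hθ1 0)
  have hκL : L * lam ^ 2 ≤ κ := by
    have h1 : κ * θ₀ ≤ κ := mul_le_of_le_one_right hκ0 hθ₀1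
    have : 0 ≤ K₀ := by positivity
    linarith
  refine h.tendsto_of_lyapunov hL hB hα hα2 hα1 (fun k => hθ₀.le.trans (hθ k)) hθ1
    (V := fun k => Φ k + b k * R k + κ * α k ^ 2 * N k) (H := G) (c := θ₀)
    (C' := C₁ / 2 + (1 + lam) * C + (K₀ + κ) * (A + B)) hθ₀ (by positivity) (fun k => le_rfl)
    (fun k => ?_) fun k => ?_
  -- With `t = 2 L b` and `G ≤ 2 L Φ`, division by `4 L` gives `Φ / 2 + b R + L b² N ≥ 0`.
  · have h1 := h.cauchy k (2 * L * b k)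
    have h2 := h.grad_le k
    have h3 : L * b k ^ 2 * N k ≤ κ * α k ^ 2 * N k := by
      have : b k ^ 2 ≤ (lam * α k) ^ 2 := pow_le_pow_left₀ (hb0 k) (hb k) 2
      have hN := h.mom_nonneg k
      calc L * b k ^ 2 * N k ≤ L * (lam * α k) ^ 2 * N k := by gcongr
        _ = (L * lam ^ 2) * α k ^ 2 * N k := by ring
        _ ≤ _ := by gcongr
    have h4 : 0 ≤ L * (2 * Φ k + 4 * (b k * R k) + 4 * (L * b k ^ 2 * N k)) := by linarith
    have h5 := nonneg_of_mul_nonneg_right h4 hL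
    linarith
  · have hG := h.grad_nonneg k
    have hN := h.mom_nonneg k
    have hN' := h.mom_nonneg (k + 1)
    have hαk := hα k
    have hbk := hb0 (k + 1)
    have hθk : 0 ≤ θ k := hθ₀.le.trans (hθ k)
    have e1 : b (k + 1) * R (k + 1) ≤ b (k + 1) * (P k + L * α k * N (k + 1)) :=
      mul_le_mul_of_nonneg_left (h.corr_succ k) hbk
    have e2 : (α k + b (k + 1)) * P k ≤ (α k + b (k + 1)) *
        ((1 - θ k) * R k - θ k * G k + θ k * (C * α k * (1 + G k))) :=
      mul_le_mul_of_nonneg_left (h.inner_le k) (by positivity)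
    -- The total coefficient of `R` is `O(α²)`: `b` nearly solves `b_k = (α_k + b_{k+1}) (1 - θ_k)`.
    have e3 : ((α k + b (k + 1)) * (1 - θ k) - b k) * R k ≤ C₁ * α k ^ 2 * ((G k + N k) / 2) := by
      refine (le_abs_self _).trans ?_
      rw [abs_mul]
      exact mul_le_mul (he k) (h.abs_corr_le k) (abs_nonneg _) (by positivity)
    have e4 : α k * θ₀ * G k ≤ (α k + b (k + 1)) * θ k * G k := by
      gcongr
      · linarith
      · exact hθ k
    have e5 : (α k + b (k + 1)) * (θ k * (C * α k * (1 + G k)))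
        ≤ (1 + lam) * C * α k ^ 2 * (1 + G k) := by
      calc (α k + b (k + 1)) * (θ k * (C * α k * (1 + G k)))
          ≤ (α k + lam * α k) * (1 * (C * α k * (1 + G k))) := by
            gcongr
            · exact hb1 k
            · exact hθ1 k
        _ = _ := by ring
    have e6 : (L / 2 * α k ^ 2 + b (k + 1) * (L * α k) + κ * α (k + 1) ^ 2) * N (k + 1)
        ≤ (K₀ + κ) * α k ^ 2 * N (k + 1) := by
      have : b (k + 1) * (L * α k) ≤ lam * α k * (L * α k) := by
        gcongr
        exact hb1 k
      have h2 : κ * α (k + 1) ^ 2 ≤ κ * α k ^ 2 := by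
        gcongr
        · exact hα _
        · exact hanti k
      refine mul_le_mul_of_nonneg_right ?_ hN'
      rw [hK₀]
      linarith
    have e7 : (K₀ + κ) * α k ^ 2 * N (k + 1)
        ≤ (K₀ + κ) * α k ^ 2 * ((1 - θ₀) * N k + (A + B) * (1 + G k)) := by
      have h1 := h.mom_succ_convex k
      have h2 : (1 - θ k) * N k ≤ (1 - θ₀) * N k := by
        gcongr
        exact hθ k
      have h3 : θ k * (A + B * G k) ≤ 1 * (A + B * G k) := by
        gcongr
        exact hθ1 k
      have h4 : 0 ≤ A * G k := by positivity
      gcongr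
      linarith
    have e8 : α k ^ 2 * N k * (C₁ / 2 + (K₀ + κ) * (1 - θ₀) - κ) ≤ 0 := by
      refine mul_nonpos_of_nonneg_of_nonpos (by positivity) ?_
      have h1 : 0 ≤ K₀ * θ₀ := by positivity
      have h2 : 0 ≤ L * lam ^ 2 := by positivity
      linarith
    have e9 := h.gap_succ k
    have e10 : 0 ≤ C₁ * α k ^ 2 := by positivity
    linarith

/-- Averaging weights comparable to the stepsizes: the Lyapunov function is
`Φ + ε R + (c / 2) N` with a small `ε`, where `c θ_k = α_k + O(α_k²)`. -/
theorem tendsto_of_weight_equiv (h : MomentRecursion L C A B α θ Φ G R N P) (hL : 0 < L)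
    (hC : 0 ≤ C) (hA : 0 ≤ A) (hB : 0 ≤ B) (hα : ∀ k, 0 ≤ α k) (hαa : ∀ k, α k ≤ a₀)
    (hα2 : Summable fun k => α k ^ 2) (hα1 : ¬ Summable α)
    {c C₁ C₂ C₃ : ℝ} (hc : 0 < c) (hC₁ : 0 ≤ C₁) (hC₂ : 0 ≤ C₂) (hC₃ : 0 < C₃)
    (hθ0 : ∀ k, 0 ≤ θ k) (hθ1 : ∀ k, θ k ≤ 1)
    (hθα : ∀ k, θ k ≤ C₂ * α k) (hαθ : ∀ k, α k ≤ C₃ * θ k)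
    (he : ∀ k, |α k - c * θ k| ≤ C₁ * α k ^ 2) :
    Tendsto G atTop (𝓝 0) := by
  -- The first two bounds give `V ≥ Φ / 2`. The third lets the friction `c θ N` dominate the `N`
  -- terms produced by `ε R` while half of it survives; `ε ≤ c` then compares that half with the
  -- required decrease.
  obtain ⟨ε, hε, hε1, hε2, hε3⟩ : ∃ ε : ℝ, 0 < ε ∧ ε * L ≤ 1 / 2 ∧ ε ≤ c ∧
      ε * (1 / 2 + L * C₃) ≤ c / 2 := by
    refine ⟨min (1 / (2 * L)) (min c (c / 2 / (1 / 2 + L * C₃))), by positivity, ?_, ?_, ?_⟩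
    · calc _ ≤ 1 / (2 * L) * L := by gcongr; exact min_le_left _ _
        _ = 1 / 2 := by field_simp
    · exact (min_le_right _ _).trans (min_le_left _ _)
    · calc _ ≤ c / 2 / (1 / 2 + L * C₃) * (1 / 2 + L * C₃) := by
            gcongr
            exact (min_le_right _ _).trans (min_le_right _ _)
        _ = c / 2 := by field_simp
  have ha₀ : 0 ≤ a₀ := (hα 0).trans (hαa 0)
  refine h.tendsto_of_lyapunov hL hB hα hα2 hα1 hθ0 hθ1
    (V := fun k => Φ k + ε * R k + c / 2 * N k) (H := fun k => G k + N k) (c := ε / (2 * C₃))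
    (C' := C₁ / 2 + (a₀ + ε) * C₂ * C + L / 2 * (1 + A + B) + ε * L * C₂ * (A + B)
      + c / 2 * C₂ ^ 2 + c * C₂ * C + c / 2 * C₂ ^ 2 * (A + B)) (by positivity) (by positivity)
    (fun k => by linarith [h.mom_nonneg k]) (fun k => ?_) fun k => ?_
  · have h1 := mul_le_mul_of_nonneg_left (neg_le_of_abs_le (h.abs_corr_le k)) hε.le
    have h2 := mul_le_mul_of_nonneg_left (h.grad_le k) hε.le
    have h3 : 0 ≤ Φ k := nonneg_of_mul_nonneg_right ((h.grad_nonneg k).trans (h.grad_le k))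
      (by positivity)
    have h4 := mul_le_mul_of_nonneg_right hε1 h3
    have h5 := mul_le_mul_of_nonneg_right hε2 (h.mom_nonneg k)
    linarith
  · have hG := h.grad_nonneg k
    have hN := h.mom_nonneg k
    have hN' := h.mom_nonneg (k + 1)
    have hαk := hα k
    have hαk' := hαa k
    have hθk := hθ0 k
    have hθk1 := hθ1 k
    have hθα' := hθα k
    have hR := h.abs_corr_le k
    have hθ2 : θ k ^ 2 ≤ C₂ ^ 2 * α k ^ 2 := by
      rw [← mul_pow]
      exact pow_le_pow_left₀ hθk hθα' 2
    have hW : A + B * G k ≤ (A + B) * (1 + (G k + N k)) := by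
      have h4 : 0 ≤ A * (G k + N k) := by positivity
      have h5 : 0 ≤ B * (1 + N k) := by positivity
      linarith
    have hW0 : 0 ≤ A + B * G k := by positivity
    have e1 : ε * R (k + 1) ≤ ε * (P k + L * α k * N (k + 1)) :=
      mul_le_mul_of_nonneg_left (h.corr_succ k) hε.le
    have e2 : (α k + ε) * P k ≤ (α k + ε) *
        ((1 - θ k) * R k - θ k * G k + θ k * (C * α k * (1 + G k))) :=
      mul_le_mul_of_nonneg_left (h.inner_le k) (by positivity)
    -- The cross term of `(c / 2) N` contributes `-c θ (1 - θ) R`, which cancels `α (1 - θ) R` from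
    -- `Φ` because `c θ` agrees with `α` to second order. Only `-ε θ R` remains, treated in `e4`.
    have e3 : (α k - c * θ k) * (1 - θ k) * R k ≤ C₁ * α k ^ 2 * ((G k + N k) / 2) := by
      refine (le_abs_self _).trans ?_
      rw [abs_mul, abs_mul, abs_of_nonneg (sub_nonneg.mpr hθk1)]
      calc |α k - c * θ k| * (1 - θ k) * |R k|
          ≤ (C₁ * α k ^ 2) * 1 * ((G k + N k) / 2) := by
            have := he k
            gcongr
            linarith
        _ = _ := by ring
    have e4 : -(ε * θ k * R k) ≤ ε * θ k * ((G k + N k) / 2) := by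
      rw [← mul_neg]
      exact mul_le_mul_of_nonneg_left ((neg_le_abs _).trans hR) (by positivity)
    have e5 : (α k + ε) * (θ k * (C * α k * (1 + G k)))
        ≤ (a₀ + ε) * C₂ * C * α k ^ 2 * (1 + (G k + N k)) := by
      calc (α k + ε) * (θ k * (C * α k * (1 + G k)))
          ≤ (a₀ + ε) * (C₂ * α k * (C * α k * (1 + (G k + N k)))) := by
            gcongr
            linarith
        _ = _ := by ring
    have e6 : L / 2 * α k ^ 2 * N (k + 1)
        ≤ L / 2 * (1 + A + B) * α k ^ 2 * (1 + (G k + N k)) := by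
      have h1 := h.mom_succ_convex k
      have h2 : (1 - θ k) * N k ≤ 1 * N k := by
        gcongr
        linarith
      have h3 : θ k * (A + B * G k) ≤ 1 * (A + B * G k) := by gcongr
      calc L / 2 * α k ^ 2 * N (k + 1)
          ≤ L / 2 * α k ^ 2 * ((1 + A + B) * (1 + (G k + N k))) := by
            gcongr
            linarith
        _ = _ := by ring
    have e7 : ε * (L * α k * N (k + 1))
        ≤ ε * L * α k * N k + ε * L * C₂ * (A + B) * α k ^ 2 * (1 + (G k + N k)) := by
      have h1 := h.mom_succ_convex k
      have h2 : (1 - θ k) * N k ≤ 1 * N k := by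
        gcongr
        linarith
      have h3 : θ k * (A + B * G k) ≤ C₂ * α k * ((A + B) * (1 + (G k + N k))) := by gcongr
      calc ε * (L * α k * N (k + 1))
          ≤ ε * (L * α k * (1 * N k + C₂ * α k * ((A + B) * (1 + (G k + N k))))) := by
            gcongr
            linarith
        _ = _ := by ring
    have e8 := mul_le_mul_of_nonneg_left (h.mom_succ k) (half_pos hc).le
    have e9 : c / 2 * (θ k ^ 2 * N k) ≤ c / 2 * C₂ ^ 2 * α k ^ 2 * (1 + (G k + N k)) := by
      calc c / 2 * (θ k ^ 2 * N k) ≤ c / 2 * (C₂ ^ 2 * α k ^ 2 * (1 + (G k + N k))) := by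
            gcongr
            linarith
        _ = _ := by ring
    have e10 : c * θ k * (1 - θ k) * (C * α k * (1 + N k))
        ≤ c * C₂ * C * α k ^ 2 * (1 + (G k + N k)) := by
      calc c * θ k * (1 - θ k) * (C * α k * (1 + N k))
          ≤ c * (C₂ * α k) * 1 * (C * α k * (1 + (G k + N k))) := by
            have : 0 ≤ 1 - θ k := by linarith
            gcongr <;> linarith
        _ = _ := by ring
    have e11 : c / 2 * (θ k ^ 2 * (A + B * G k))
        ≤ c / 2 * C₂ ^ 2 * (A + B) * α k ^ 2 * (1 + (G k + N k)) := by
      calc c / 2 * (θ k ^ 2 * (A + B * G k))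
          ≤ c / 2 * (C₂ ^ 2 * α k ^ 2 * ((A + B) * (1 + (G k + N k)))) := by gcongr
        _ = _ := by ring
    have e12 : ε * θ k * G k ≤ (α k + ε) * θ k * G k := by
      gcongr
      linarith
    have e13 : ε * L * α k * N k ≤ ε * L * (C₃ * θ k) * N k := by
      gcongr
      exact hαθ k
    have e14 : ε * (1 / 2 + L * C₃) * (θ k * N k) ≤ c / 2 * (θ k * N k) := by gcongr
    have e15 : ε / (2 * C₃) * α k * (G k + N k) ≤ ε / 2 * θ k * (G k + N k) := by
      have h1 : ε / (2 * C₃) * α k ≤ ε / (2 * C₃) * (C₃ * θ k) := by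
        gcongr
        exact hαθ k
      have h2 : ε / (2 * C₃) * (C₃ * θ k) = ε / 2 * θ k := by field_simp
      rw [h2] at h1
      gcongr
    have e16 : ε * (θ k * N k) ≤ c * (θ k * N k) := by gcongr
    have e17 := h.gap_succ k
    have e18 : 0 ≤ C₁ * α k ^ 2 := by positivity
    linarith

end MomentRecursion

/-! ### Averaging weights and the momentum update -/

/-- The reciprocal of the weight that the newest step gets in `m_{k+1}`. -/
noncomputable def weightDenom (γ : ℕ → ℝ) (k : ℕ) : ℝ :=
  1 + ∑ i ∈ Finset.Icc 1 k, weight γ k i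

theorem weight_succ (γ : ℕ → ℝ) {k j : ℕ} (hj : j ≤ k + 1) :
    weight γ (k + 1) j = γ (k + 1) * weight γ k j := by
  rw [weight, weight, Finset.prod_Icc_succ_top hj, mul_comm]

theorem weight_succ_self (γ : ℕ → ℝ) (k : ℕ) : weight γ (k + 1) (k + 1) = γ (k + 1) := by
  simp [weight]

theorem sum_weight_succ (γ : ℕ → ℝ) (k : ℕ) :
    ∑ i ∈ Finset.Icc 1 (k + 1), weight γ (k + 1) i = γ (k + 1) * weightDenom γ k := by
  rw [Finset.sum_Icc_succ_top (by omega), weight_succ_self, weightDenom, mul_add, mul_one, add_comm,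
    Finset.mul_sum]
  congr 1
  exact Finset.sum_congr rfl fun i hi =>
    weight_succ γ (by have := (Finset.mem_Icc.mp hi).2; omega)

theorem weightDenom_zero (γ : ℕ → ℝ) : weightDenom γ 0 = 1 := by simp [weightDenom]

theorem weightDenom_succ (γ : ℕ → ℝ) (k : ℕ) :
    weightDenom γ (k + 1) = 1 + γ (k + 1) * weightDenom γ k := by
  rw [weightDenom, sum_weight_succ]

theorem one_le_weightDenom {γ : ℕ → ℝ} (hγ : ∀ k, 1 ≤ k → 0 < γ k) (k : ℕ) :
    1 ≤ weightDenom γ k := by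
  induction k with
  | zero => rw [weightDenom_zero]
  | succ k ih =>
    rw [weightDenom_succ]
    have := mul_nonneg (hγ (k + 1) (by omega)).le (zero_le_one.trans ih)
    linarith

theorem IsDecayFactor.pos {γ : ℕ → ℝ} (hγ : IsDecayFactor γ) (k : ℕ) (hk : 1 ≤ k) : 0 < γ k := by
  rcases hγ with ⟨p, -, h⟩ | ⟨c, hc, -, h⟩
  · rw [h k hk]
    have : (0 : ℝ) < k := by exact_mod_cast hk
    positivity
  · rwa [h k hk]

theorem momentum_zero {d : ℕ} (γ α : ℕ → ℝ) (s : ℕ → Vec d) : momentum γ α s 0 = 0 := by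
  simp [momentum]

/-- The weighted average is updated by a convex combination with the newest direction. -/
theorem momentum_succ {d : ℕ} {γ : ℕ → ℝ} (hγ : ∀ k, 1 ≤ k → 0 < γ k) (α : ℕ → ℝ)
    (s : ℕ → Vec d) (k : ℕ) :
    momentum γ α s (k + 1) = (1 - (weightDenom γ k)⁻¹) • momentum γ α s k
      + (weightDenom γ k)⁻¹ • (α (k + 1))⁻¹ • s (k + 1) := by
  have hg := hγ (k + 1) (by omega)
  have hD : 0 < weightDenom γ k := one_pos.trans_le (one_le_weightDenom hγ k)
  have hsum : ∑ j ∈ Finset.Icc 1 k, (weight γ (k + 1) j / α j) • s j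
      = γ (k + 1) • (weightDenom γ k - 1) • momentum γ α s k := by
    have h1 : ∑ j ∈ Finset.Icc 1 k, (weight γ (k + 1) j / α j) • s j
        = γ (k + 1) • ∑ j ∈ Finset.Icc 1 k, (weight γ k j / α j) • s j := by
      rw [Finset.smul_sum]
      refine Finset.sum_congr rfl fun j hj => ?_
      rw [weight_succ γ (by have := (Finset.mem_Icc.mp hj).2; omega), smul_smul, mul_div_assoc]
    rw [h1, momentum]
    congr 1
    -- At `k = 0` the weights have an empty sum, so no inverse can be cancelled, but both sides
    -- vanish.
    rcases k with _ | k
    · simp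
    · have h2 : 0 < ∑ i ∈ Finset.Icc 1 (k + 1), weight γ (k + 1) i := by
        rw [sum_weight_succ]
        exact mul_pos (hγ _ (by omega)) (one_pos.trans_le (one_le_weightDenom hγ k))
      rw [weightDenom, add_sub_cancel_left, smul_smul, mul_inv_cancel₀ h2.ne', one_smul]
  rw [momentum, sum_weight_succ, Finset.sum_Icc_succ_top (by omega), hsum, weight_succ_self,
    smul_add, smul_smul, smul_smul, smul_smul, smul_smul]
  congr 2
  · field_simp
  · field_simp

/-! ### Stepsizes -/

section Stepsize

variable {β σ : ℝ}

theorem stepsize_pos (hβ : 0 < β) (hσ : 0 < σ) (k : ℕ) : 0 < stepsize β σ k := by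
  rw [stepsize]
  positivity

theorem stepsize_succ_le (hβ : 0 < β) (hσ : 0 < σ) (k : ℕ) :
    stepsize β σ (k + 1) ≤ stepsize β σ k := by
  rw [stepsize, stepsize]
  gcongr
  linarith

theorem stepsize_le (hβ : 0 < β) (hσ : 0 < σ) (k : ℕ) : stepsize β σ k ≤ β / σ := by
  rw [stepsize]
  gcongr
  have : (0 : ℝ) ≤ k := k.cast_nonneg
  linarith

theorem not_summable_stepsize (hβ : 0 < β) (hσ : 0 < σ) :
    ¬ Summable fun k => stepsize β σ (k + 1) := by
  intro h
  have h1 : Summable fun k : ℕ => (1 : ℝ) / ((k + 1 : ℕ) : ℝ) := by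
    refine Summable.of_nonneg_of_le (fun k => by positivity) (fun k => ?_)
      (h.mul_left ((1 + σ) / β))
    have hk : (0 : ℝ) ≤ k := k.cast_nonneg
    rw [stepsize]
    push_cast
    rw [div_mul_div_comm, mul_comm (1 + σ) β, mul_div_mul_left _ _ hβ.ne',
      div_le_div_iff₀ (by positivity) (by positivity)]
    nlinarith [mul_nonneg hσ.le hk]
  exact Real.not_summable_one_div_natCast ((summable_nat_add_iff 1).mp h1)

theorem summable_stepsize_sq (hβ : 0 < β) (hσ : 0 < σ) :
    Summable fun k => stepsize β σ (k + 1) ^ 2 := by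
  have h1 : Summable fun k : ℕ => (1 : ℝ) / ((k + 1 : ℕ) : ℝ) ^ 2 :=
    (summable_nat_add_iff 1).mpr (Real.summable_one_div_nat_pow.mpr one_lt_two)
  refine Summable.of_nonneg_of_le (fun k => by positivity) (fun k => ?_) (h1.mul_left (β ^ 2))
  have hk : (0 : ℝ) ≤ k := k.cast_nonneg
  rw [stepsize, div_pow, mul_one_div]
  push_cast
  exact div_le_div_of_nonneg_left (by positivity) (by positivity)
    (pow_le_pow_left₀ (by positivity) (by linarith) 2)

end Stepsize

/-! ### Asymptotics of the weights for the two decay factors -/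

theorem weightDenom_of_const {γ : ℕ → ℝ} {c : ℝ} (hγ : ∀ k, 1 ≤ k → γ k = c) (k : ℕ) :
    (1 - c) * weightDenom γ k = 1 - c ^ (k + 1) := by
  induction k with
  | zero => simp [weightDenom_zero]
  | succ k ih =>
    rw [weightDenom_succ, hγ (k + 1) (by omega)]
    linear_combination c * ih

/-- The transient `c ^ k` of the geometric weights is negligible on the scale of the stepsizes,
since `(k + σ) c ^ k` is bounded. -/
theorem exists_pow_le_stepsize {β σ c : ℝ} (hβ : 0 < β) (hσ : 0 < σ) (hc0 : 0 < c) (hc1 : c < 1) :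
    ∃ C, 0 ≤ C ∧ ∀ k : ℕ, c ^ k ≤ C * stepsize β σ k := by
  have h1 : Tendsto (fun k : ℕ => (k : ℝ) * c ^ k + σ * c ^ k) atTop (𝓝 (0 + σ * 0)) :=
    (tendsto_self_mul_const_pow_of_lt_one hc0.le hc1).add
      ((tendsto_pow_atTop_nhds_zero_of_lt_one hc0.le hc1).const_mul σ)
  obtain ⟨b, hb⟩ := h1.bddAbove_range
  have hb' : ∀ k : ℕ, ((k : ℝ) + σ) * c ^ k ≤ b := fun k => by
    rw [add_mul]
    exact hb ⟨k, rfl⟩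
  have hb0 : 0 ≤ b := le_trans (by positivity) (hb' 0)
  refine ⟨b / β, by positivity, fun k => ?_⟩
  have hk : 0 < (k : ℝ) + σ := by positivity
  rw [stepsize, div_mul_div_comm, mul_comm b β, mul_div_mul_left _ _ hβ.ne', le_div_iff₀ hk,
    mul_comm]
  exact hb' k

theorem MomentRecursion.tendsto_of_const {L C A B β σ c : ℝ} {γ Φ G R N P : ℕ → ℝ}
    (hβ : 0 < β) (hσ : 0 < σ)
    (h : MomentRecursion L C A B (fun k => stepsize β σ (k + 1)) (fun k => (weightDenom γ k)⁻¹)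
      Φ G R N P)
    (hL : 0 < L) (hC : 0 ≤ C) (hA : 0 ≤ A) (hB : 0 ≤ B) (hc0 : 0 < c) (hc1 : c < 1)
    (hγ : ∀ k, 1 ≤ k → γ k = c) : Tendsto G atTop (𝓝 0) := by
  obtain ⟨C₀, hC₀, hpow⟩ := exists_pow_le_stepsize hβ hσ hc0 hc1
  have h1c : 0 < 1 - c := by linarith
  have hγ0 : ∀ k, 1 ≤ k → 0 < γ k := fun k hk => by rwa [hγ k hk]
  have hD1 := one_le_weightDenom hγ0
  have hDle : ∀ k, weightDenom γ k ≤ (1 - c)⁻¹ := fun k => by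
    rw [← mul_le_mul_iff_right₀ h1c, weightDenom_of_const hγ, mul_inv_cancel₀ h1c.ne']
    have : 0 < c ^ (k + 1) := by positivity
    linarith
  have hα := fun k => stepsize_pos hβ hσ k
  have hbs : ∀ k, weightDenom γ (k + 1) - 1 = c * weightDenom γ k := fun k => by
    rw [weightDenom_succ, hγ _ (by omega)]
    ring
  refine h.tendsto_of_weight_ge hL hC hA hB (fun k => (hα _).le) (summable_stepsize_sq hβ hσ)
    (not_summable_stepsize hβ hσ) (fun k => stepsize_succ_le hβ hσ _)
    (θ₀ := 1 - c) (lam := (1 - c)⁻¹) (C₁ := (1 - c)⁻¹ * (C₀ + 1 / β))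
    -- With `θ = 1 / D`, this is `α (1 - θ) / θ`, the stationary solution of `b = (α + b) (1 - θ)`:
    -- the total displacement still to come from the present momentum if `α` and `θ` were frozen.
    (b := fun k => stepsize β σ (k + 1) * (weightDenom γ k - 1)) h1c
    (fun k => ?_) (fun k => inv_le_one_of_one_le₀ (hD1 k)) (by positivity) (by positivity)
    (fun k => mul_nonneg (hα _).le (by linarith [hD1 k])) (fun k => ?_) (fun k => ?_) fun k => ?_
  · rw [le_inv_comm₀ h1c (one_pos.trans_le (hD1 k))]
    exact hDle k
  · rw [mul_comm]
    have := (hα (k + 1)).le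
    gcongr
    linarith [hDle k]
  · rw [mul_comm]
    have := (hα (k + 1 + 1)).le
    gcongr
    · linarith [hDle (k + 1)]
    · exact stepsize_succ_le hβ hσ _
  · have hD0 := one_pos.trans_le (hD1 k)
    have hDc := weightDenom_of_const hγ k
    have hDl := hDle k
    have hp := hpow (k + 1)
    have ha := hα (k + 1)
    have hdiff0 : 0 ≤ stepsize β σ (k + 1) - stepsize β σ (k + 1 + 1) := by
      linarith [stepsize_succ_le hβ hσ (k + 1)]
    have hdiff : stepsize β σ (k + 1) - stepsize β σ (k + 1 + 1)
        ≤ 1 / β * stepsize β σ (k + 1) ^ 2 := by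
      have hk : (0 : ℝ) ≤ k := k.cast_nonneg
      simp only [stepsize]
      push_cast
      rw [div_sub_div _ _ (by positivity) (by positivity), div_pow, div_mul_div_comm,
        div_le_div_iff₀ (by positivity) (by positivity)]
      have : 0 < (k : ℝ) + 1 + σ := by positivity
      have : 0 < β ^ 2 * ((k : ℝ) + 1 + σ) := by positivity
      linarith
    -- The defect has two sources, the transient `c ^ (k + 1)` of the weights and the change of the
    -- stepsize; with the factor `α` on the transient, both are `O(α²)`.
    have hrw : (stepsize β σ (k + 1) + stepsize β σ (k + 1 + 1) * (weightDenom γ (k + 1) - 1))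
        * (1 - (weightDenom γ k)⁻¹) - stepsize β σ (k + 1) * (weightDenom γ k - 1)
        = (weightDenom γ k - 1) * (stepsize β σ (k + 1) * c ^ (k + 1) * (weightDenom γ k)⁻¹
          - c * (stepsize β σ (k + 1) - stepsize β σ (k + 1 + 1))) := by
      rw [hbs, show c ^ (k + 1) = 1 - (1 - c) * weightDenom γ k by linarith]
      field_simp
      ring
    rw [hrw, abs_mul, abs_of_nonneg (by linarith [hD1 k])]
    have hinv : (weightDenom γ k)⁻¹ ≤ 1 := inv_le_one_of_one_le₀ (hD1 k)
    have h2 : |stepsize β σ (k + 1) * c ^ (k + 1) * (weightDenom γ k)⁻¹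
          - c * (stepsize β σ (k + 1) - stepsize β σ (k + 1 + 1))|
        ≤ (C₀ + 1 / β) * stepsize β σ (k + 1) ^ 2 := by
      refine (abs_sub _ _).trans ?_
      rw [abs_of_nonneg (by positivity), abs_of_nonneg (by positivity)]
      have e1 : stepsize β σ (k + 1) * c ^ (k + 1) * (weightDenom γ k)⁻¹
          ≤ stepsize β σ (k + 1) * (C₀ * stepsize β σ (k + 1)) * 1 := by gcongr
      have e2 : c * (stepsize β σ (k + 1) - stepsize β σ (k + 1 + 1))
          ≤ 1 * (1 / β * stepsize β σ (k + 1) ^ 2) := by gcongr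
      linarith
    exact (mul_le_mul (by linarith) h2 (abs_nonneg _) (by positivity)).trans_eq
      (mul_assoc _ _ _).symm

/-- Here `D_k = ∑_{i=1}^{k+1} (i / (k + 1)) ^ p`, essentially a Riemann sum for `(k + 1) / (p + 1)`.
An error bounded uniformly in `k` is what makes `α - c θ` of order `α²`. -/
theorem weightDenom_of_rpow {γ : ℕ → ℝ} {p : ℝ} (hp : 0 < p)
    (hγ : ∀ k : ℕ, 1 ≤ k → γ k = ((k : ℝ) / ((k : ℝ) + 1)) ^ p) (k : ℕ) :
    (k : ℝ) + 1 ≤ (p + 1) * weightDenom γ k ∧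
      (p + 1) * weightDenom γ k ≤ (k : ℝ) + 1 + (p + 1) := by
  induction k with
  | zero =>
    rw [weightDenom_zero]
    push_cast
    constructor <;> linarith
  | succ k ih =>
    rw [weightDenom_succ, hγ (k + 1) (by omega)]
    push_cast
    set K : ℝ := (k : ℝ) + 1 with hK
    have hK0 : 0 < K := by positivity
    set x := K / (K + 1) with hx
    have hx0 : 0 < x := by positivity
    have hx1 : x - 1 = -(1 / (K + 1)) := by rw [hx]; field_simp; ring
    constructor
    -- Bernoulli's inequality, with `x ^ p * K = x ^ (p + 1) * (K + 1)`.
    · have h1 : 1 + (p + 1) * (x - 1) ≤ (1 + (x - 1)) ^ (p + 1) :=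
        one_add_mul_self_le_rpow_one_add (by linarith) (by linarith)
      rw [add_sub_cancel, Real.rpow_add hx0, Real.rpow_one] at h1
      have h2 : x * (K + 1) = K := by rw [hx]; field_simp
      have h3 : (1 + (p + 1) * (x - 1)) * (K + 1) ≤ x ^ p * x * (K + 1) := by gcongr
      have h4 : (x - 1) * (K + 1) = -1 := by linarith
      have h5 : x ^ p * K ≤ x ^ p * ((p + 1) * weightDenom γ k) := by
        gcongr
        exact ih.1
      have h6 : (1 + (p + 1) * (x - 1)) * (K + 1) = K + 1 - (p + 1) := by
        linear_combination (p + 1) * h4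
      have h7 : x ^ p * x * (K + 1) = x ^ p * K := by rw [mul_assoc, h2]
      linarith
    -- From `log x ≤ x - 1` and `1 + t ≤ exp t`; the denominator is exactly what the upper induction
    -- bound needs.
    · have h1 : x ^ p ≤ (K + 1) / (K + 1 + p) := by
        rw [Real.rpow_def_of_pos hx0]
        calc Real.exp (Real.log x * p) ≤ Real.exp (-(p / (K + 1))) := by
              gcongr
              have := mul_le_mul_of_nonneg_right (Real.log_le_sub_one_of_pos hx0) hp.le
              rw [hx1] at this
              calc _ ≤ _ := this
                _ = _ := by ring
          _ = (Real.exp (p / (K + 1)))⁻¹ := Real.exp_neg _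
          _ ≤ (p / (K + 1) + 1)⁻¹ := by
              gcongr
              exact Real.add_one_le_exp _
          _ = _ := by field_simp; ring
      have h2 : x ^ p * ((p + 1) * weightDenom γ k) ≤ (K + 1) / (K + 1 + p) * (K + (p + 1)) := by
        have : 0 ≤ K + (p + 1) := by positivity
        calc _ ≤ x ^ p * (K + (p + 1)) := by
              gcongr
              exact ih.2
          _ ≤ _ := by gcongr
      have h3 : (K + 1) / (K + 1 + p) * (K + (p + 1)) = K + 1 := by field_simp; ring
      linarith

theorem MomentRecursion.tendsto_of_rpow {L C A B β σ p : ℝ} {γ Φ G R N P : ℕ → ℝ}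
    (hβ : 0 < β) (hσ : 0 < σ)
    (h : MomentRecursion L C A B (fun k => stepsize β σ (k + 1)) (fun k => (weightDenom γ k)⁻¹)
      Φ G R N P)
    (hL : 0 < L) (hC : 0 ≤ C) (hA : 0 ≤ A) (hB : 0 ≤ B) (hp : 0 < p)
    (hγ : ∀ k : ℕ, 1 ≤ k → γ k = ((k : ℝ) / ((k : ℝ) + 1)) ^ p) : Tendsto G atTop (𝓝 0) := by
  have hD := weightDenom_of_rpow hp hγ
  have hγ0 : ∀ k, 1 ≤ k → 0 < γ k := IsDecayFactor.pos (Or.inl ⟨p, hp, hγ⟩)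
  have hD1 := one_le_weightDenom hγ0
  have hα := fun k => stepsize_pos hβ hσ k
  have hp1 : 0 < p + 1 := by linarith
  refine h.tendsto_of_weight_equiv hL hC hA hB (fun k => (hα _).le) (fun k => stepsize_le hβ hσ _)
    (summable_stepsize_sq hβ hσ) (not_summable_stepsize hβ hσ)
    -- `c` is the limit of `α / θ = β D / (k + 1 + σ)`, as `D ~ (k + 1) / (p + 1)`. The factors `1 +
    -- σ` come from `k + 1 + σ ≤ (1 + σ) (k + 1)`.
    (c := β / (p + 1)) (C₁ := (1 + p + σ) * (1 + σ) / β) (C₂ := (p + 1) * (1 + σ) / β)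
    (C₃ := β * (p + 2) / (p + 1)) (by positivity) (by positivity) (by positivity) (by positivity)
    (fun k => (inv_pos.mpr (one_pos.trans_le (hD1 k))).le)
    (fun k => inv_le_one_of_one_le₀ (hD1 k)) (fun k => ?_) (fun k => ?_) fun k => ?_
  all_goals
    obtain ⟨h1, h2⟩ := hD k
    have hD0 := one_pos.trans_le (hD1 k)
    have hk : (0 : ℝ) ≤ k := k.cast_nonneg
    simp only [stepsize]
    push_cast
    set D := weightDenom γ k
    set K := (k : ℝ) + 1
    have hK : 1 ≤ K := by simp only [K]; linarith
    have hKσ : 0 < K + σ := by linarith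
  · rw [div_mul_div_comm, mul_comm _ β, mul_div_mul_left _ _ hβ.ne', inv_eq_one_div,
      div_le_div_iff₀ hD0 hKσ]
    have e1 := mul_le_mul_of_nonneg_right h1 (by linarith : 0 ≤ 1 + σ)
    nlinarith
  · rw [← div_eq_mul_inv, div_div, div_le_div_iff₀ hKσ (by positivity)]
    have e1 : β * ((p + 1) * D) ≤ β * ((p + 2) * (K + σ)) := by
      refine mul_le_mul_of_nonneg_left ?_ hβ.le
      nlinarith
    linarith
  · have hK0 : 0 < K := by linarith
    have e0 : β / (K + σ) - β / (p + 1) * D⁻¹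
        = β * ((p + 1) * D - (K + σ)) / ((K + σ) * ((p + 1) * D)) := by
      field_simp
    rw [e0, abs_div, abs_mul, abs_of_pos hβ,
      abs_of_pos (by positivity : 0 < (K + σ) * ((p + 1) * D))]
    have e1 : |(p + 1) * D - (K + σ)| ≤ 1 + p + σ := by
      rw [abs_le]
      constructor <;> linarith
    calc β * |(p + 1) * D - (K + σ)| / ((K + σ) * ((p + 1) * D))
        ≤ β * (1 + p + σ) / ((K + σ) * K) :=
          div_le_div₀ (by positivity) (by gcongr) (by positivity) (by gcongr)
      _ ≤ β * (1 + p + σ) / ((K + σ) * ((K + σ) / (1 + σ))) := by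
          gcongr
          rw [div_le_iff₀ (by positivity)]
          nlinarith
      _ = _ := by field_simp

/-- The deterministic core of the convergence proof. -/
theorem MomentRecursion.tendsto_of_isDecayFactor {L C A B β σ : ℝ} {γ Φ G R N P : ℕ → ℝ}
    (hβ : 0 < β) (hσ : 0 < σ)
    (h : MomentRecursion L C A B (fun k => stepsize β σ (k + 1)) (fun k => (weightDenom γ k)⁻¹)
      Φ G R N P)
    (hL : 0 < L) (hC : 0 ≤ C) (hA : 0 ≤ A) (hB : 0 ≤ B) (hγ : IsDecayFactor γ) :
    Tendsto G atTop (𝓝 0) := by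
  rcases hγ with ⟨p, hp, hγ⟩ | ⟨c, hc0, hc1, hγ⟩
  · exact h.tendsto_of_rpow hβ hσ hL hC hA hB hp hγ
  · exact h.tendsto_of_const hβ hσ hL hC hA hB hc0 hc1 hγ

/-! ### Functions with Lipschitz gradient -/

section Smooth

variable {d : ℕ} {F : Vec d → ℝ} {L : ℝ}

theorem HasLipschitzGradient.continuous_gradient (h : HasLipschitzGradient F L) :
    Continuous (gradient F) := by
  have : LipschitzWith (Real.toNNReal L) (gradient F) :=
    LipschitzWith.of_dist_le_mul fun x y => by
      rw [dist_eq_norm, dist_eq_norm]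
      exact (h.lipschitz y x).trans (by gcongr; exact Real.le_coe_toNNReal L)
  exact this.continuous

/-- Mean value inequality on the segment: the derivative of the remainder at `t` is bounded by `L
‖v‖² t`, the derivative of `L / 2 ‖v‖² t²`. -/
theorem HasLipschitzGradient.abs_taylor_le (h : HasLipschitzGradient F L) (x v : Vec d) :
    |F (x + v) - F x - inner ℝ (gradient F x) v| ≤ L / 2 * ‖v‖ ^ 2 := by
  have hd : Differentiable ℝ F := h.contDiff.differentiable one_ne_zero
  have hderiv : ∀ t : ℝ, HasDerivAt
      (fun t : ℝ => F (x + t • v) - F x - t * inner ℝ (gradient F x) v)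
      (inner ℝ (gradient F (x + t • v)) v - inner ℝ (gradient F x) v) t := fun t => by
    have h1 : HasDerivAt (fun t : ℝ => x + t • v) v t := by
      simpa using ((hasDerivAt_id t).smul_const v).const_add x
    have h2 := (hd (x + t • v)).hasFDerivAt.comp_hasDerivAt t h1
    rw [← inner_gradient_left] at h2
    refine ((h2.sub_const (F x)).sub
      ((hasDerivAt_id t).mul_const (inner ℝ (gradient F x) v))).congr_deriv ?_
    rw [one_mul]
  have key := image_norm_le_of_norm_deriv_right_le_deriv_boundary (E := ℝ) (a := 0) (b := 1)
    (f := fun t : ℝ => F (x + t • v) - F x - t * inner ℝ (gradient F x) v)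
    (B := fun t => L / 2 * ‖v‖ ^ 2 * t ^ 2) (B' := fun t => L * ‖v‖ ^ 2 * t)
    (fun t _ => (hderiv t).continuousAt.continuousWithinAt)
    (fun t _ => (hderiv t).hasDerivWithinAt) (by simp)
    (fun t => by
      have := (hasDerivAt_pow 2 t).const_mul (L / 2 * ‖v‖ ^ 2)
      refine this.congr_deriv ?_
      simp only [Nat.cast_ofNat, Nat.add_one_sub_one, pow_one]
      ring)
    (fun t ht => by
      rw [← inner_sub_left]
      calc ‖inner ℝ (gradient F (x + t • v) - gradient F x) v‖
          ≤ ‖gradient F (x + t • v) - gradient F x‖ * ‖v‖ := norm_inner_le_norm _ _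
        _ ≤ L * ‖x + t • v - x‖ * ‖v‖ := by
            gcongr
            exact h.lipschitz _ _
        _ = L * ‖v‖ ^ 2 * t := by
            rw [add_sub_cancel_left, norm_smul, Real.norm_of_nonneg ht.1]
            ring)
    (Set.right_mem_Icc.mpr zero_le_one)
  simpa using key

/-- A gradient step of length `1 / L` lowers `F` by at least `‖∇F‖² / (2 L)` and cannot pass below
`b`. -/
theorem HasLipschitzGradient.norm_gradient_sq_le (h : HasLipschitzGradient F L) (hL : 0 < L)
    {b : ℝ} (hb : ∀ x, b ≤ F x) (x : Vec d) : ‖gradient F x‖ ^ 2 ≤ 2 * L * (F x - b) := by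
  have h1 := (abs_le.mp (h.abs_taylor_le x (-(1 / L) • gradient F x))).2
  rw [inner_smul_right, real_inner_self_eq_norm_sq, norm_smul, mul_pow, norm_neg,
    Real.norm_of_nonneg (by positivity)] at h1
  have h2 := hb (x + -(1 / L) • gradient F x)
  have h3 : L / 2 * ((1 / L) ^ 2 * ‖gradient F x‖ ^ 2) = ‖gradient F x‖ ^ 2 / (2 * L) := by
    field_simp
  have h4 : -(1 / L) * ‖gradient F x‖ ^ 2 = - (2 * (‖gradient F x‖ ^ 2 / (2 * L))) := by
    field_simp
  rw [h3, h4] at h1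
  have h5 : ‖gradient F x‖ ^ 2 / (2 * L) ≤ F x - b := by linarith
  rwa [div_le_iff₀ (by positivity), mul_comm] at h5

theorem HasLipschitzGradient.memLp_gradient {Ω : Type*} [MeasurableSpace Ω] {μ : Measure Ω}
    [IsProbabilityMeasure μ] (h : HasLipschitzGradient F L) {X : Ω → Vec d} (hX : MemLp X 2 μ) :
    MemLp (fun ω => gradient F (X ω)) 2 μ := by
  have hg : MemLp (fun ω => ‖gradient F 0‖ + L * ‖X ω‖) 2 μ :=
    (memLp_const ‖gradient F 0‖).add (hX.norm.const_mul L)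
  refine hg.mono'
    (h.continuous_gradient.comp_aestronglyMeasurable hX.1) (Eventually.of_forall fun ω => ?_)
  have h1 := h.lipschitz 0 (X ω)
  have h2 := norm_sub_norm_le (gradient F (X ω)) (gradient F 0)
  rw [sub_zero] at h1
  linarith

theorem HasLipschitzGradient.integrable_comp {Ω : Type*} [MeasurableSpace Ω] {μ : Measure Ω}
    [IsProbabilityMeasure μ] (h : HasLipschitzGradient F L) {X : Ω → Vec d} (hX : MemLp X 2 μ) :
    Integrable (fun ω => F (X ω)) μ := by
  refine Integrable.mono' (g := fun ω => |F 0| + ‖gradient F 0‖ * ‖X ω‖ + L / 2 * ‖X ω‖ ^ 2) ?_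
    (h.contDiff.continuous.comp_aestronglyMeasurable hX.1) (Eventually.of_forall fun ω => ?_)
  · exact ((integrable_const _).add ((hX.integrable one_le_two).norm.const_mul _)).add
      (hX.integrable_norm_pow two_ne_zero |>.const_mul _)
  · have h1 := h.abs_taylor_le 0 (X ω)
    have h2 := abs_real_inner_le_norm (gradient F 0) (X ω)
    rw [zero_add] at h1
    rw [Real.norm_eq_abs]
    have h3 : F (X ω) = (F (X ω) - F 0 - inner ℝ (gradient F 0) (X ω)) + F 0
        + inner ℝ (gradient F 0) (X ω) := by ring
    have h4 := abs_add_three (F (X ω) - F 0 - inner ℝ (gradient F 0) (X ω)) (F 0)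
      (inner ℝ (gradient F 0) (X ω))
    rw [← h3] at h4
    linarith

end Smooth

theorem integrable_inner_of_memLp {Ω : Type*} [MeasurableSpace Ω] {μ : Measure Ω} {d : ℕ}
    {f g : Ω → Vec d} (hf : MemLp f 2 μ) (hg : MemLp g 2 μ) :
    Integrable (fun ω => inner ℝ (f ω) (g ω)) μ :=
  (hf.norm.integrable_mul hg.norm).mono' (hf.1.inner hg.1)
    (Eventually.of_forall fun _ => norm_inner_le_norm _ _)

theorem integrable_const_add_mul_norm_sq {Ω : Type*} [MeasurableSpace Ω] {μ : Measure Ω}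
    [IsProbabilityMeasure μ] {d : ℕ} {f : Ω → Vec d} (hf : MemLp f 2 μ) (a b : ℝ) :
    Integrable (fun ω => a + b * ‖f ω‖ ^ 2) μ :=
  (integrable_const _).add ((hf.integrable_norm_pow two_ne_zero).const_mul _)

/-! ### Integrating out independent seeds -/

section Fresh

variable {Ω 𝒵 𝒲 E : Type*} [MeasurableSpace Ω] [MeasurableSpace 𝒵] [MeasurableSpace 𝒲]
  {μ : Measure Ω} [IsProbabilityMeasure μ] {Z : Ω → 𝒵} {W : Ω → 𝒲}

theorem lintegral_indep (hZ : Measurable Z) (hW : Measurable W) (hind : IndepFun Z W μ)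
    {h : 𝒵 → 𝒲 → ENNReal} (hh : Measurable (Function.uncurry h)) :
    ∫⁻ ω, h (Z ω) (W ω) ∂μ = ∫⁻ ω, ∫⁻ ω', h (Z ω) (W ω') ∂μ ∂μ := by
  have h1 : ∫⁻ ω, h (Z ω) (W ω) ∂μ = ∫⁻ p, Function.uncurry h p ∂(μ.map fun ω => (Z ω, W ω)) :=
    (lintegral_map hh (hZ.prodMk hW)).symm
  rw [h1, (indepFun_iff_map_prod_eq_prod_map_map hZ.aemeasurable hW.aemeasurable).mp hind,
    lintegral_prod _ hh.aemeasurable, lintegral_map hh.lintegral_prod_right' hZ]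
  refine lintegral_congr fun ω => ?_
  exact lintegral_map (hh.comp measurable_prodMk_left) hW

/-- Fubini for the product law of `(Z, W)`. The inner integral freezes the past `Z ω` and plays the
role of a conditional expectation. -/
theorem integral_indep [NormedAddCommGroup E] [NormedSpace ℝ E] (hZ : Measurable Z)
    (hW : Measurable W) (hind : IndepFun Z W μ) {h : 𝒵 → 𝒲 → E}
    (hh : StronglyMeasurable (Function.uncurry h)) (hint : Integrable (fun ω => h (Z ω) (W ω)) μ) :
    ∫ ω, h (Z ω) (W ω) ∂μ = ∫ ω, ∫ ω', h (Z ω) (W ω') ∂μ ∂μ := by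
  have h1 : ∫ ω, h (Z ω) (W ω) ∂μ = ∫ p, Function.uncurry h p ∂(μ.map fun ω => (Z ω, W ω)) :=
    (integral_map (hZ.prodMk hW).aemeasurable hh.aestronglyMeasurable).symm
  have h2 : Integrable (Function.uncurry h) (μ.map fun ω => (Z ω, W ω)) :=
    (integrable_map_measure hh.aestronglyMeasurable (hZ.prodMk hW).aemeasurable).mpr hint
  have h3 := (indepFun_iff_map_prod_eq_prod_map_map hZ.aemeasurable hW.aemeasurable).mp hind
  rw [h3] at h2
  rw [h1, h3, integral_prod _ h2, integral_map hZ.aemeasurable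
    hh.integral_prod_right'.aestronglyMeasurable]
  refine integral_congr_ae (Eventually.of_forall fun ω => ?_)
  exact integral_map hW.aemeasurable
    (hh.comp_measurable measurable_prodMk_left).aestronglyMeasurable

end Fresh

/-! ### Moments of a conditionally almost unbiased estimator -/

section OneStep

variable {Ω 𝒵 𝒲 : Type*} [MeasurableSpace Ω] [MeasurableSpace 𝒵] [MeasurableSpace 𝒲]
  {μ : Measure Ω} [IsProbabilityMeasure μ] {d : ℕ} {W : Ω → 𝒲} {Z : Ω → 𝒵}
  {T : 𝒵 → 𝒲 → Vec d} {g : 𝒵 → Vec d} {M MV c : ℝ}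

/-- `T(z, W)` is a stochastic estimate of `-g(z)` with bias at most `c` and variance at most
`M + MV ‖g(z)‖²`, for almost every value `z` of `Z`. -/
structure IsEstimator (μ : Measure Ω) (Z : Ω → 𝒵) (W : Ω → 𝒲) (T : 𝒵 → 𝒲 → Vec d)
    (g : 𝒵 → Vec d) (M MV c : ℝ) : Prop where
  measurable_state : Measurable Z
  measurable_seed : Measurable W
  indep : IndepFun Z W μ
  measurable_map : Measurable (Function.uncurry T)
  measurable_grad : Measurable g
  memLp : ∀ᵐ ω ∂μ, MemLp (fun ω' => T (Z ω) (W ω')) 2 μ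
  variance : ∀ᵐ ω ∂μ, ∫ ω', ‖T (Z ω) (W ω')‖ ^ 2 ∂μ - ‖∫ ω', T (Z ω) (W ω') ∂μ‖ ^ 2
    ≤ M + MV * ‖g (Z ω)‖ ^ 2
  bias : ∀ᵐ ω ∂μ, ‖∫ ω', T (Z ω) (W ω') ∂μ + g (Z ω)‖ ≤ c

namespace IsEstimator

/-- The conditional second moment is variance plus squared mean, and the mean has norm at most `c +
‖g‖`. Lower integrals avoid assuming the integrability that `memLp_comp` then derives. -/
theorem lintegral_le (h : IsEstimator μ Z W T g M MV c) :
    ∫⁻ ω, ‖T (Z ω) (W ω)‖ₑ ^ 2 ∂μ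
      ≤ ∫⁻ ω, ENNReal.ofReal ((M + 2 * c ^ 2) + (MV + 2) * ‖g (Z ω)‖ ^ 2) ∂μ := by
  rw [lintegral_indep h.measurable_state h.measurable_seed h.indep
    (h := fun z w => ‖T z w‖ₑ ^ 2) (h.measurable_map.enorm.pow_const 2)]
  refine lintegral_mono_ae ?_
  filter_upwards [h.memLp, h.variance, h.bias] with ω h1 h2 h3
  have h4 : ∫⁻ ω', ‖T (Z ω) (W ω')‖ₑ ^ 2 ∂μ
      = ENNReal.ofReal (∫ ω', ‖T (Z ω) (W ω')‖ ^ 2 ∂μ) := by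
    rw [ofReal_integral_eq_lintegral_ofReal (h1.integrable_norm_pow two_ne_zero)
      (Eventually.of_forall fun _ => by positivity)]
    refine lintegral_congr fun ω' => ?_
    rw [ENNReal.ofReal_pow (norm_nonneg _), ofReal_norm]
  rw [h4]
  refine ENNReal.ofReal_le_ofReal ?_
  have h5 : ‖∫ ω', T (Z ω) (W ω') ∂μ‖ ≤ c + ‖g (Z ω)‖ := by
    have := norm_sub_le (∫ ω', T (Z ω) (W ω') ∂μ + g (Z ω)) (g (Z ω))
    rw [add_sub_cancel_right] at this
    linarith
  have h6 : ‖∫ ω', T (Z ω) (W ω') ∂μ‖ ^ 2 ≤ (c + ‖g (Z ω)‖) ^ 2 :=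
    pow_le_pow_left₀ (norm_nonneg _) h5 2
  nlinarith [sq_nonneg (c - ‖g (Z ω)‖)]

theorem memLp_comp (h : IsEstimator μ Z W T g M MV c) (hg : MemLp (fun ω => g (Z ω)) 2 μ) :
    MemLp (fun ω => T (Z ω) (W ω)) 2 μ := by
  refine ⟨(h.measurable_map.comp
    (h.measurable_state.prodMk h.measurable_seed)).aestronglyMeasurable, ?_⟩
  rw [eLpNorm_lt_top_iff_lintegral_rpow_enorm_lt_top two_ne_zero ENNReal.ofNat_ne_top]
  have h1 := h.lintegral_le.trans_lt (integrable_const_add_mul_norm_sq hg _ _).lintegral_lt_top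
  simpa using h1

theorem integral_norm_sq_le (h : IsEstimator μ Z W T g M MV c) (hM : 0 ≤ M) (hMV : 0 ≤ MV)
    (hg : MemLp (fun ω => g (Z ω)) 2 μ) :
    ∫ ω, ‖T (Z ω) (W ω)‖ ^ 2 ∂μ
      ≤ (M + 2 * c ^ 2) + (MV + 2) * ∫ ω, ‖g (Z ω)‖ ^ 2 ∂μ := by
  have hnn : ∀ ω, 0 ≤ (M + 2 * c ^ 2) + (MV + 2) * ‖g (Z ω)‖ ^ 2 := fun ω => by positivity
  have h1 := h.lintegral_le
  rw [← ofReal_integral_eq_lintegral_ofReal (integrable_const_add_mul_norm_sq hg _ _)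
    (Eventually.of_forall hnn)] at h1
  have h2 : ∫⁻ ω, ‖T (Z ω) (W ω)‖ₑ ^ 2 ∂μ
      = ENNReal.ofReal (∫ ω, ‖T (Z ω) (W ω)‖ ^ 2 ∂μ) := by
    rw [ofReal_integral_eq_lintegral_ofReal ((h.memLp_comp hg).integrable_norm_pow two_ne_zero)
      (Eventually.of_forall fun _ => by positivity)]
    refine lintegral_congr fun ω' => ?_
    rw [ENNReal.ofReal_pow (norm_nonneg _), ofReal_norm]
  rw [h2, ENNReal.ofReal_le_ofReal_iff (integral_nonneg hnn)] at h1
  refine h1.trans_eq ?_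
  rw [integral_add (integrable_const _) ((hg.integrable_norm_pow two_ne_zero).const_mul _),
    integral_const_mul]
  simp

/-- Inner products with functions of the past see only the bias. -/
theorem integral_inner_le (h : IsEstimator μ Z W T g M MV c) (hc : 0 ≤ c)
    (hg : MemLp (fun ω => g (Z ω)) 2 μ) {φ : 𝒵 → Vec d} (hφ : Measurable φ)
    (hφ2 : MemLp (fun ω => φ (Z ω)) 2 μ) :
    ∫ ω, inner ℝ (φ (Z ω)) (T (Z ω) (W ω)) ∂μ
      ≤ -∫ ω, inner ℝ (φ (Z ω)) (g (Z ω)) ∂μ + c * (1 + ∫ ω, ‖φ (Z ω)‖ ^ 2 ∂μ) := by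
  have hφi : Integrable (fun ω => ‖φ (Z ω)‖ ^ 2) μ := hφ2.integrable_norm_pow two_ne_zero
  have hφg : Integrable (fun ω => inner ℝ (φ (Z ω)) (g (Z ω))) μ := integrable_inner_of_memLp hφ2 hg
  have hφ1 : Integrable (fun ω => c * (1 + ‖φ (Z ω)‖ ^ 2)) μ :=
    ((integrable_const _).add hφi).const_mul c
  have hrhs : Integrable (fun ω => -inner ℝ (φ (Z ω)) (g (Z ω)) + c * (1 + ‖φ (Z ω)‖ ^ 2)) μ :=
    hφg.neg.add hφ1
  have hmeas : Measurable (Function.uncurry fun z w => (inner ℝ (φ z) (T z w) : ℝ)) :=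
    (hφ.comp measurable_fst).inner h.measurable_map
  have hint : Integrable (fun ω => inner ℝ (φ (Z ω)) (T (Z ω) (W ω))) μ :=
    integrable_inner_of_memLp hφ2 (h.memLp_comp hg)
  have h1 := integral_indep h.measurable_state h.measurable_seed h.indep
    hmeas.stronglyMeasurable hint
  have h2 : ∫ ω, -inner ℝ (φ (Z ω)) (g (Z ω)) + c * (1 + ‖φ (Z ω)‖ ^ 2) ∂μ
      = -∫ ω, inner ℝ (φ (Z ω)) (g (Z ω)) ∂μ + c * (1 + ∫ ω, ‖φ (Z ω)‖ ^ 2 ∂μ) := by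
    rw [integral_add (f := fun ω => -inner ℝ (φ (Z ω)) (g (Z ω))) hφg.neg hφ1, integral_neg,
      integral_const_mul, integral_add (integrable_const _) hφi]
    simp
  rw [h1, ← h2]
  have hint' : Integrable (fun ω => ∫ ω', inner ℝ (φ (Z ω)) (T (Z ω) (W ω')) ∂μ) μ := by
    have h3 := (integrable_map_measure hmeas.aestronglyMeasurable
      (h.measurable_state.prodMk h.measurable_seed).aemeasurable).mpr hint
    rw [(indepFun_iff_map_prod_eq_prod_map_map h.measurable_state.aemeasurable
      h.measurable_seed.aemeasurable).mp h.indep] at h3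
    have h4 := h3.integral_prod_left.comp_measurable h.measurable_state
    refine h4.congr (Eventually.of_forall fun ω => ?_)
    exact integral_map h.measurable_seed.aemeasurable
      (hmeas.comp measurable_prodMk_left).aestronglyMeasurable
  refine integral_mono_ae hint' hrhs ?_
  filter_upwards [h.memLp, h.bias] with ω hm hb
  rw [integral_inner (hm.integrable one_le_two)]
  have h5 : inner ℝ (φ (Z ω)) (∫ ω', T (Z ω) (W ω') ∂μ)
      = -inner ℝ (φ (Z ω)) (g (Z ω))
        + inner ℝ (φ (Z ω)) (∫ ω', T (Z ω) (W ω') ∂μ + g (Z ω)) := by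
    rw [inner_add_right]
    ring
  have h6 : inner ℝ (φ (Z ω)) (∫ ω', T (Z ω) (W ω') ∂μ + g (Z ω)) ≤ ‖φ (Z ω)‖ * c :=
    (real_inner_le_norm _ _).trans (by gcongr)
  -- Replacing `‖φ‖` by `1 + ‖φ‖²` keeps the bias term within the second moments tracked by the
  -- recursion.
  have h7 : ‖φ (Z ω)‖ * c ≤ (1 + ‖φ (Z ω)‖ ^ 2) * c := by
    gcongr
    nlinarith [sq_nonneg (‖φ (Z ω)‖ - 1)]
  rw [h5]
  linarith

end IsEstimator

end OneStep

/-! ### Random directions and the bias of finite differences -/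

section Direction

variable {d : ℕ} {Q : Measure (Vec d)} [IsProbabilityMeasure Q]

theorem IsDirectionLaw.memLp_four (hQ : IsDirectionLaw Q) : MemLp (fun u : Vec d => u) 4 Q := by
  obtain ⟨r, m4, h⟩ := hQ.bounded_or_fourth
  refine MemLp.of_eval_piLp fun i => ?_
  have hm : Measurable fun u : Vec d => u i := by fun_prop
  rcases h i with hb | ⟨hi, -⟩
  · exact MemLp.of_bound hm.aestronglyMeasurable r hb
  · rw [← integrable_norm_rpow_iff hm.aestronglyMeasurable (by norm_num) ENNReal.ofNat_ne_top]
    refine hi.congr (Eventually.of_forall fun u => ?_)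
    rw [ENNReal.toReal_ofNat]
    norm_cast
    exact ((even_two_mul 2).pow_abs (u i)).symm

theorem IsDirectionLaw.integrable_norm_pow (hQ : IsDirectionLaw Q) {k : ℕ} (hk : k ≤ 4) :
    Integrable (fun u : Vec d => ‖u‖ ^ k) Q := by
  have : MemLp (fun u : Vec d => u) k Q := hQ.memLp_four.mono_exponent (by exact_mod_cast hk)
  exact this.integrable_norm_pow'

theorem IsDirectionLaw.integrable_inner_smul (hQ : IsDirectionLaw Q) (v : Vec d) :
    Integrable (fun u : Vec d => inner ℝ v u • u) Q := by
  refine ((hQ.integrable_norm_pow (k := 2) (by norm_num)).const_mul ‖v‖).mono'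
    (by fun_prop) (Eventually.of_forall fun u => ?_)
  rw [norm_smul, sq, ← mul_assoc]
  gcongr
  exact norm_inner_le_norm _ _

/-- The identity covariance makes `u uᵀ` average to the identity matrix, so random directional
derivatives recover the gradient. -/
theorem IsDirectionLaw.integral_inner_smul (hQ : IsDirectionLaw Q) (v : Vec d) :
    ∫ u : Vec d, inner ℝ v u • u ∂Q = v := by
  ext i
  have h1 := (EuclideanSpace.proj (𝕜 := ℝ) i).integral_comp_comm (hQ.integrable_inner_smul v)
  have hij : ∀ j, Integrable (fun u : Vec d => u j * u i) Q := fun j => by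
    refine (hQ.integrable_norm_pow (k := 2) (by norm_num)).mono' (by fun_prop)
      (Eventually.of_forall fun u => ?_)
    rw [norm_mul, sq]
    gcongr <;> exact PiLp.norm_apply_le _ _
  calc (∫ u : Vec d, inner ℝ v u • u ∂Q) i = ∫ u : Vec d, (inner ℝ v u • u) i ∂Q := h1.symm
    _ = ∫ u : Vec d, ∑ j, v j * (u j * u i) ∂Q := by
        refine integral_congr_ae (Eventually.of_forall fun u => ?_)
        simp only [PiLp.smul_apply, smul_eq_mul, PiLp.inner_apply, Finset.sum_mul]
        refine Finset.sum_congr rfl fun j _ => ?_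
        simp only [RCLike.inner_apply, conj_trivial]
        ring
    _ = ∑ j, v j * ∫ u : Vec d, u j * u i ∂Q := by
        rw [integral_finsetSum _ fun j _ => (hij j).const_mul _]
        simp only [integral_const_mul]
    _ = v i := by simp [hQ.cov]

variable {F : Vec d → ℝ} {L : ℝ}

/-- By the Taylor bound the difference grows at most quadratically in `u`, so a third moment
suffices. -/
theorem integrable_diff_smul (hQ : IsDirectionLaw Q) (hF : HasLipschitzGradient F L)
    (a : ℝ) (x : Vec d) : Integrable (fun u : Vec d => (F x - F (x + a • u)) • u) Q := by
  have hc := hF.contDiff.continuous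
  refine (((hQ.integrable_norm_pow (k := 2) (by norm_num)).const_mul (‖gradient F x‖ * |a|)).add
    ((hQ.integrable_norm_pow (k := 3) (by norm_num)).const_mul (L / 2 * a ^ 2))).mono'
    (by fun_prop) (Eventually.of_forall fun u => ?_)
  have h1 := hF.abs_taylor_le x (a • u)
  have h2 : |inner ℝ (gradient F x) (a • u)| ≤ ‖gradient F x‖ * (|a| * ‖u‖) := by
    simpa [norm_smul] using abs_real_inner_le_norm (gradient F x) (a • u)
  have h3 : |F x - F (x + a • u)| ≤ ‖gradient F x‖ * (|a| * ‖u‖) + L / 2 * (|a| * ‖u‖) ^ 2 := by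
    have := abs_add_le (F (x + a • u) - F x - inner ℝ (gradient F x) (a • u))
      (inner ℝ (gradient F x) (a • u))
    rw [sub_add_cancel, abs_sub_comm] at this
    rw [norm_smul, Real.norm_eq_abs] at h1
    linarith
  rw [norm_smul, Real.norm_eq_abs]
  calc |F x - F (x + a • u)| * ‖u‖
      ≤ (‖gradient F x‖ * (|a| * ‖u‖) + L / 2 * (|a| * ‖u‖) ^ 2) * ‖u‖ := by gcongr
    _ = ‖gradient F x‖ * |a| * ‖u‖ ^ 2 + L / 2 * |a| ^ 2 * ‖u‖ ^ 3 := by ring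
    _ = _ := by rw [sq_abs]; rfl

/-- The gradient-free step is, up to `O(a²)`, a gradient step in expectation. -/
theorem norm_integral_diff_smul_add_le (hQ : IsDirectionLaw Q) (hF : HasLipschitzGradient F L)
    (a : ℝ) (x : Vec d) :
    ‖∫ u : Vec d, (F x - F (x + a • u)) • u ∂Q + a • gradient F x‖
      ≤ L / 2 * a ^ 2 * ∫ u : Vec d, ‖u‖ ^ 3 ∂Q := by
  have h1 : a • gradient F x = ∫ u : Vec d, a • inner ℝ (gradient F x) u • u ∂Q := by
    rw [integral_smul, hQ.integral_inner_smul]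
  have h1' : Integrable (fun u : Vec d => a • inner ℝ (gradient F x) u • u) Q :=
    (hQ.integrable_inner_smul (gradient F x)).smul a
  rw [h1, ← integral_add (integrable_diff_smul hQ hF a x) h1', ← integral_const_mul]
  refine norm_integral_le_of_norm_le ((hQ.integrable_norm_pow (by norm_num)).const_mul _)
    (Eventually.of_forall fun u => ?_)
  have h2 := hF.abs_taylor_le x (a • u)
  rw [norm_smul, mul_pow, Real.norm_eq_abs, sq_abs, inner_smul_right] at h2
  rw [smul_smul, ← add_smul, norm_smul, Real.norm_eq_abs,
    show F x - F (x + a • u) + a * inner ℝ (gradient F x) u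
      = -(F (x + a • u) - F x - a * inner ℝ (gradient F x) u) by ring, abs_neg]
  calc _ ≤ L / 2 * (a ^ 2 * ‖u‖ ^ 2) * ‖u‖ := by gcongr
    _ = _ := by ring

end Direction

/-! ### Expectation of the mini-batch step -/

section Step

variable {Ω Ξ : Type*} [MeasurableSpace Ω] [MeasurableSpace Ξ] {d n m : ℕ}
  {f : Vec d → Ξ → ℝ}

theorem measurable_step {A : Type*} [MeasurableSpace A] (hf : Measurable (Function.uncurry f))
    (a : ℝ) {x : A → Vec d} {z : A → Fin n → Fin m → Ξ} {u : A → Fin n → Vec d}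
    (hx : Measurable x) (hz : Measurable z) (hu : Measurable u) :
    Measurable fun q => step f a (x q) (z q) (u q) := by
  have h0 : ∀ i, Measurable fun q => u q i := fun i => (measurable_pi_apply i).comp hu
  have h1 : ∀ i j, Measurable fun q => f (x q) (z q i j) - f (x q + a • u q i) (z q i j) :=
    fun i j => by
      have hzij : Measurable fun q => z q i j :=
        (measurable_pi_apply j).comp ((measurable_pi_apply i).comp hz)
      exact (hf.comp (hx.prodMk hzij)).sub (hf.comp ((hx.add ((h0 i).const_smul a)).prodMk hzij))
  have h2 : ∀ i, Measurable fun q =>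
      ((m : ℝ)⁻¹ * ∑ j, (f (x q) (z q i j) - f (x q + a • u q i) (z q i j))) • u q i :=
    fun i => ((Finset.measurable_fun_sum _ fun j _ => h1 i j).const_mul _).smul (h0 i)
  have h3 := Finset.measurable_fun_sum Finset.univ fun i _ => h2 i
  exact h3.const_smul ((n : ℝ)⁻¹)

theorem integral_step_sample {μ : Measure Ω} {P : Measure Ξ} (hf : Measurable (Function.uncurry f))
    (hfint : ∀ x, Integrable (f x) P) (hm : 0 < m) {ξ : Fin n → Fin m → Ω → Ξ}
    (hξ : ∀ i j, Measurable (ξ i j)) (hξP : ∀ i j, μ.map (ξ i j) = P) (a : ℝ) (x : Vec d)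
    (u : Fin n → Vec d) :
    ∫ ω, step f a x (fun i j => ξ i j ω) u ∂μ
      = (n : ℝ)⁻¹ • ∑ i, (objective P f x - objective P f (x + a • u i)) • u i := by
  have hm' : (m : ℝ) ≠ 0 := by exact_mod_cast hm.ne'
  have hfi : ∀ y i j, Integrable (fun ω => f y (ξ i j ω)) μ := fun y i j => by
    have := hfint y
    rw [← hξP i j] at this
    exact this.comp_measurable (hξ i j)
  have hfe : ∀ y i j, ∫ ω, f y (ξ i j ω) ∂μ = objective P f y := fun y i j => by
    rw [objective, ← hξP i j, integral_map (hξ i j).aemeasurable]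
    exact (hf.comp measurable_prodMk_left).aestronglyMeasurable
  have hd : ∀ i j, Integrable (fun ω => f x (ξ i j ω) - f (x + a • u i) (ξ i j ω)) μ :=
    fun i j => (hfi _ i j).sub (hfi _ i j)
  have hs : ∀ i, Integrable (fun ω => (m : ℝ)⁻¹ *
      ∑ j, (f x (ξ i j ω) - f (x + a • u i) (ξ i j ω))) μ :=
    fun i => (integrable_finsetSum _ fun j _ => hd i j).const_mul _
  unfold step
  rw [integral_smul, integral_finsetSum _ fun i _ => (hs i).smul_const (u i)]
  congr 1
  refine Finset.sum_congr rfl fun i _ => ?_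
  rw [integral_smul_const, integral_const_mul, integral_finsetSum _ fun j _ => hd i j]
  congr 1
  have he : ∀ j, ∫ ω, f x (ξ i j ω) - f (x + a • u i) (ξ i j ω) ∂μ
      = objective P f x - objective P f (x + a • u i) := fun j => by
    rw [integral_sub (hfi _ i j) (hfi _ i j), hfe, hfe]
  rw [Finset.sum_congr rfl fun j _ => he j, Finset.sum_const, Finset.card_univ, Fintype.card_fin,
    nsmul_eq_mul]
  field_simp


/-- Integrating the samples with frozen directions turns `f` into `F`; the summands then share one
mean, as all directions have law `Q`. Batch sizes thus do not affect the bias. -/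
theorem integral_step {μ : Measure Ω} [IsProbabilityMeasure μ] {P : Measure Ξ}
    {Q : Measure (Vec d)} [IsProbabilityMeasure Q]
    {L : ℝ} (hf : Measurable (Function.uncurry f)) (hfint : ∀ x, Integrable (f x) P)
    (hF : HasLipschitzGradient (objective P f) L) (hQ : IsDirectionLaw Q)
    (hn : 0 < n) (hm : 0 < m)
    {ξ : Fin n → Fin m → Ω → Ξ} {ζ : Fin n → Ω → Vec d}
    (hξ : ∀ i j, Measurable (ξ i j)) (hζ : ∀ i, Measurable (ζ i))
    (hξP : ∀ i j, μ.map (ξ i j) = P) (hζQ : ∀ i, μ.map (ζ i) = Q)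
    (hind : IndepFun (fun ω i j => ξ i j ω) (fun ω i => ζ i ω) μ) (a : ℝ) (x : Vec d)
    (hint : Integrable (fun ω => step f a x (fun i j => ξ i j ω) (fun i => ζ i ω)) μ) :
    ∫ ω, step f a x (fun i j => ξ i j ω) (fun i => ζ i ω) ∂μ
      = ∫ u : Vec d, (objective P f x - objective P f (x + a • u)) • u ∂Q := by
  have hn' : (n : ℝ) ≠ 0 := by exact_mod_cast hn.ne'
  have hmeas : Measurable (Function.uncurry fun (u : Fin n → Vec d) (z : Fin n → Fin m → Ξ) =>
      step f a x z u) :=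
    measurable_step hf a measurable_const measurable_snd measurable_fst
  have hξm : Measurable fun ω i j => ξ i j ω :=
    measurable_pi_lambda _ fun i => measurable_pi_lambda _ fun j => hξ i j
  have hζm : Measurable fun ω i => ζ i ω := measurable_pi_lambda _ hζ
  have hsm : StronglyMeasurable (Function.uncurry fun (u : Fin n → Vec d) (z : Fin n → Fin m → Ξ) =>
      step f a x z u) := Measurable.stronglyMeasurable hmeas
  have hind' : IndepFun (fun ω i => ζ i ω) (fun ω i j => ξ i j ω) μ := hind.symm
  have h1 : ∫ ω, step f a x (fun i j => ξ i j ω) (fun i => ζ i ω) ∂μ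
      = ∫ ω, ∫ ω', step f a x (fun i j => ξ i j ω') (fun i => ζ i ω) ∂μ ∂μ := by
    have := integral_indep (E := Vec d) (h := fun u z => step f a x z u) hζm hξm hind' hsm
    exact this hint
  rw [h1]
  have hinner : ∀ ω, ∫ ω', step f a x (fun i j => ξ i j ω') (fun i => ζ i ω) ∂μ
      = (n : ℝ)⁻¹ • ∑ i, (objective P f x - objective P f (x + a • ζ i ω)) • ζ i ω := fun ω =>
    integral_step_sample hf hfint hm hξ hξP a x fun i => ζ i ω
  rw [integral_congr_ae (Eventually.of_forall hinner)]
  have hdi := integrable_diff_smul hQ hF a x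
  have hdi' : ∀ i, Integrable (fun ω =>
      (objective P f x - objective P f (x + a • ζ i ω)) • ζ i ω) μ := fun i => by
    have := hdi
    rw [← hζQ i] at this
    exact this.comp_measurable (hζ i)
  have hde : ∀ i, ∫ ω, (objective P f x - objective P f (x + a • ζ i ω)) • ζ i ω ∂μ
      = ∫ u : Vec d, (objective P f x - objective P f (x + a • u)) • u ∂Q := fun i => by
    conv_rhs => rw [← hζQ i]
    rw [integral_map (hζ i).aemeasurable]
    rw [hζQ i]
    exact hdi.1
  rw [integral_smul, integral_finsetSum _ fun i _ => hdi' i]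
  rw [Finset.sum_congr rfl fun i _ => hde i, Finset.sum_const, Finset.card_univ, Fintype.card_fin,
    ← Nat.cast_smul_eq_nsmul ℝ, smul_smul, inv_mul_cancel₀ hn', one_smul]

end Step

/-! ### From step estimates to the moment recursion -/

theorem integrable_add_mul_add_mul {Ω : Type*} [MeasurableSpace Ω] {μ : Measure Ω}
    {f g h : Ω → ℝ} (hf : Integrable f μ) (hg : Integrable g μ) (hh : Integrable h μ) (a b : ℝ) :
    Integrable (fun ω => f ω + a * g ω + b * h ω) μ :=
  (hf.add (hg.const_mul a)).add (hh.const_mul b)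

theorem integral_add_mul_add_mul {Ω : Type*} [MeasurableSpace Ω] {μ : Measure Ω}
    {f g h : Ω → ℝ} (hf : Integrable f μ) (hg : Integrable g μ) (hh : Integrable h μ) (a b : ℝ) :
    ∫ ω, (f ω + a * g ω + b * h ω) ∂μ = ∫ ω, f ω ∂μ + a * ∫ ω, g ω ∂μ + b * ∫ ω, h ω ∂μ := by
  have h1 : Integrable (fun ω => f ω + a * g ω) μ := hf.add (hg.const_mul a)
  rw [integral_add h1 (hh.const_mul b), integral_add hf (hg.const_mul a), integral_const_mul,
    integral_const_mul]

/-- The moment inequalities of a momentum method driven by directions `T k` that estimate the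
negative gradient. -/
theorem momentRecursion_of_estimates {Ω : Type*} [MeasurableSpace Ω] {μ : Measure Ω}
    [IsProbabilityMeasure μ] {d : ℕ} {F : Vec d → ℝ} {L C A B b : ℝ} {α θ : ℕ → ℝ}
    {X V T : ℕ → Ω → Vec d} (hF : HasLipschitzGradient F L) (hL : 0 < L) (hb : ∀ x, b ≤ F x)
    (hα : ∀ k, 0 ≤ α k) (hθ0 : ∀ k, 0 ≤ θ k) (hθ1 : ∀ k, θ k ≤ 1)
    (hX : ∀ k, MemLp (X k) 2 μ) (hV : ∀ k, MemLp (V k) 2 μ) (hT : ∀ k, MemLp (T k) 2 μ)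
    (hVsucc : ∀ k ω, V (k + 1) ω = (1 - θ k) • V k ω + θ k • T k ω)
    (hXsucc : ∀ k ω, X (k + 1) ω = X k ω + α k • V (k + 1) ω)
    (hgT : ∀ k, ∫ ω, inner ℝ (gradient F (X k ω)) (T k ω) ∂μ
      ≤ -∫ ω, ‖gradient F (X k ω)‖ ^ 2 ∂μ
        + C * α k * (1 + ∫ ω, ‖gradient F (X k ω)‖ ^ 2 ∂μ))
    (hVT : ∀ k, ∫ ω, inner ℝ (V k ω) (T k ω) ∂μ
      ≤ -∫ ω, inner ℝ (gradient F (X k ω)) (V k ω) ∂μ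
        + C * α k * (1 + ∫ ω, ‖V k ω‖ ^ 2 ∂μ))
    (hTT : ∀ k, ∫ ω, ‖T k ω‖ ^ 2 ∂μ ≤ A + B * ∫ ω, ‖gradient F (X k ω)‖ ^ 2 ∂μ) :
    MomentRecursion L C A B α θ (fun k => ∫ ω, (F (X k ω) - b) ∂μ)
      (fun k => ∫ ω, ‖gradient F (X k ω)‖ ^ 2 ∂μ)
      (fun k => ∫ ω, inner ℝ (gradient F (X k ω)) (V k ω) ∂μ)
      (fun k => ∫ ω, ‖V k ω‖ ^ 2 ∂μ)
      (fun k => ∫ ω, inner ℝ (gradient F (X k ω)) (V (k + 1) ω) ∂μ) := by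
  have hg := fun k => hF.memLp_gradient (hX k)
  have iF : ∀ k, Integrable (fun ω => F (X k ω) - b) μ := fun k =>
    (hF.integrable_comp (hX k)).sub (integrable_const _)
  have ig : ∀ k, Integrable (fun ω => ‖gradient F (X k ω)‖ ^ 2) μ := fun k =>
    (hg k).integrable_norm_pow two_ne_zero
  have iV : ∀ k, Integrable (fun ω => ‖V k ω‖ ^ 2) μ := fun k =>
    (hV k).integrable_norm_pow two_ne_zero
  have iT : ∀ k, Integrable (fun ω => ‖T k ω‖ ^ 2) μ := fun k =>
    (hT k).integrable_norm_pow two_ne_zero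
  have igV : ∀ k l, Integrable (fun ω => inner ℝ (gradient F (X k ω)) (V l ω)) μ := fun k l =>
    integrable_inner_of_memLp (hg k) (hV l)
  have igT : ∀ k, Integrable (fun ω => inner ℝ (gradient F (X k ω)) (T k ω)) μ := fun k =>
    integrable_inner_of_memLp (hg k) (hT k)
  have iVT : ∀ k, Integrable (fun ω => inner ℝ (V k ω) (T k ω)) μ := fun k =>
    integrable_inner_of_memLp (hV k) (hT k)
  have hnorm : ∀ k ω, ‖V (k + 1) ω‖ ^ 2 = (1 - θ k) ^ 2 * ‖V k ω‖ ^ 2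
      + 2 * θ k * (1 - θ k) * inner ℝ (V k ω) (T k ω) + θ k ^ 2 * ‖T k ω‖ ^ 2 := fun k ω => by
    rw [hVsucc, norm_add_sq_real, norm_smul, norm_smul, inner_smul_left, inner_smul_right, mul_pow,
      mul_pow, Real.norm_eq_abs, Real.norm_eq_abs, sq_abs, sq_abs, conj_trivial]
    ring
  have hgsub : ∀ k ω, ‖gradient F (X (k + 1) ω) - gradient F (X k ω)‖ ≤ L * α k * ‖V (k + 1) ω‖ :=
    fun k ω => by
      have := hF.lipschitz (X k ω) (X (k + 1) ω)
      rw [hXsucc k ω, add_sub_cancel_left, norm_smul, Real.norm_of_nonneg (hα k), ← mul_assoc]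
        at this
      rwa [hXsucc k ω]
  refine ⟨fun k => ?_, fun k => ?_, fun k => ?_, fun k t => ?_, fun k => ?_, fun k => ?_,
    fun k => ?_, fun k => ?_, fun k => ?_, fun k => ?_⟩
  · exact integral_nonneg fun ω => sq_nonneg _
  · exact integral_nonneg fun ω => sq_nonneg _
  · rw [← integral_const_mul]
    exact integral_mono (ig k) ((iF k).const_mul _) fun ω => hF.norm_gradient_sq_le hL hb _
  · have h1 : 0 ≤ ∫ ω, (‖gradient F (X k ω)‖ ^ 2
        + 2 * t * inner ℝ (gradient F (X k ω)) (V k ω) + t ^ 2 * ‖V k ω‖ ^ 2) ∂μ := by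
      refine integral_nonneg fun ω => ?_
      have h2 := norm_add_sq_real (gradient F (X k ω)) (t • V k ω)
      rw [norm_smul, mul_pow, Real.norm_eq_abs, sq_abs, inner_smul_right] at h2
      have h3 := sq_nonneg ‖gradient F (X k ω) + t • V k ω‖
      dsimp only [Pi.zero_apply]
      linarith
    rwa [integral_add_mul_add_mul (ig k) (igV k k) (iV k)] at h1
  · rw [← integral_add_mul_add_mul (iF k) (igV k (k + 1)) (iV (k + 1))]
    refine integral_mono (iF (k + 1))
      (integrable_add_mul_add_mul (iF k) (igV k (k + 1)) (iV (k + 1)) _ _) fun ω => ?_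
    have h1 := (abs_le.mp (hF.abs_taylor_le (X k ω) (α k • V (k + 1) ω))).2
    rw [← hXsucc, norm_smul, mul_pow, Real.norm_eq_abs, sq_abs, inner_smul_right] at h1
    dsimp only
    linarith
  · rw [← integral_const_mul, ← integral_add (igV k (k + 1)) ((iV (k + 1)).const_mul _)]
    refine integral_mono (igV (k + 1) (k + 1))
      ((igV k (k + 1)).add ((iV (k + 1)).const_mul _)) fun ω => ?_
    have h1 := real_inner_le_norm (gradient F (X (k + 1) ω) - gradient F (X k ω)) (V (k + 1) ω)
    have h2 := mul_le_mul_of_nonneg_right (hgsub k ω) (norm_nonneg (V (k + 1) ω))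
    rw [inner_sub_left] at h1
    dsimp only
    linarith
  · have h1 : ∫ ω, inner ℝ (gradient F (X k ω)) (V (k + 1) ω) ∂μ
        = (1 - θ k) * ∫ ω, inner ℝ (gradient F (X k ω)) (V k ω) ∂μ
          + θ k * ∫ ω, inner ℝ (gradient F (X k ω)) (T k ω) ∂μ := by
      rw [← integral_const_mul, ← integral_const_mul,
        ← integral_add ((igV k k).const_mul _) ((igT k).const_mul _)]
      refine integral_congr_ae (Eventually.of_forall fun ω => ?_)
      dsimp only
      rw [hVsucc, inner_add_right, inner_smul_right, inner_smul_right]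
    have h2 := mul_le_mul_of_nonneg_left (hgT k) (hθ0 k)
    rw [h1]
    linarith
  · have h1 : ∫ ω, ‖V (k + 1) ω‖ ^ 2 ∂μ = (1 - θ k) ^ 2 * ∫ ω, ‖V k ω‖ ^ 2 ∂μ
        + 2 * θ k * (1 - θ k) * ∫ ω, inner ℝ (V k ω) (T k ω) ∂μ
        + θ k ^ 2 * ∫ ω, ‖T k ω‖ ^ 2 ∂μ := by
      rw [← integral_const_mul,
        ← integral_add_mul_add_mul ((iV k).const_mul _) (iVT k) (iT k)]
      exact integral_congr_ae (Eventually.of_forall fun ω => hnorm k ω)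
    rw [h1]
    have h2 := mul_le_mul_of_nonneg_left (hTT k) (sq_nonneg (θ k))
    have h3 := mul_le_mul_of_nonneg_left (hVT k)
      (mul_nonneg (mul_nonneg zero_le_two (hθ0 k)) (sub_nonneg.mpr (hθ1 k)))
    linarith
  · have h1 : ∫ ω, ‖V (k + 1) ω‖ ^ 2 ∂μ
        ≤ (1 - θ k) * ∫ ω, ‖V k ω‖ ^ 2 ∂μ + θ k * ∫ ω, ‖T k ω‖ ^ 2 ∂μ := by
      rw [← integral_const_mul, ← integral_const_mul,
        ← integral_add ((iV k).const_mul _) ((iT k).const_mul _)]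
      refine integral_mono (iV (k + 1)) (((iV k).const_mul _).add ((iT k).const_mul _)) fun ω => ?_
      have h2 := norm_sub_sq_real (V k ω) (T k ω)
      -- `θ (1 - θ) ‖V - T‖²` is exactly the convexity defect of the squared norm.
      have h3 := mul_nonneg (mul_nonneg (hθ0 k) (sub_nonneg.mpr (hθ1 k)))
        (sq_nonneg ‖V k ω - T k ω‖)
      rw [h2] at h3
      dsimp only
      rw [hnorm]
      linarith
    have h2 := mul_le_mul_of_nonneg_left (hTT k) (hθ0 k)
    linarith
  · have igN : Integrable (fun ω => ‖gradient F (X k ω)‖ ^ 2 + ‖V (k + 1) ω‖ ^ 2) μ :=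
      (ig k).add (iV (k + 1))
    rw [← integral_add (ig k) (iV (k + 1)), ← integral_add_mul_add_mul (ig k) igN (iV (k + 1))]
    refine integral_mono (ig (k + 1))
      (integrable_add_mul_add_mul (ig k) igN (iV (k + 1)) _ _) fun ω => ?_
    have h1 := norm_sub_norm_le (gradient F (X (k + 1) ω)) (gradient F (X k ω))
    have h2 : ‖gradient F (X (k + 1) ω)‖ ≤ ‖gradient F (X k ω)‖ + L * α k * ‖V (k + 1) ω‖ := by
      linarith [hgsub k ω]
    have h3 := pow_le_pow_left₀ (norm_nonneg _) h2 2
    have h4 := mul_nonneg (mul_nonneg hL.le (hα k))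
      (sq_nonneg (‖gradient F (X k ω)‖ - ‖V (k + 1) ω‖))
    dsimp only
    linarith

/-! ### Independence of past and fresh seeds -/

section Independence

variable {Ω : Type*} {mΩ : MeasurableSpace Ω} {μ : Measure Ω}

theorem iIndep_sumElim {ι κ : Type*} {a : ι → MeasurableSpace Ω} {b : κ → MeasurableSpace Ω}
    (ha : iIndep a μ) (hb : iIndep b μ) (hab : Indep (⨆ i, a i) (⨆ j, b j) μ) :
    iIndep (Sum.elim a b) μ := by
  rw [iIndep_iff]
  intro s t ht
  have hl : ∀ i ∈ s.toLeft, MeasurableSet[a i] (t (Sum.inl i)) := fun i hi =>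
    ht _ (Finset.mem_toLeft.mp hi)
  have hr : ∀ j ∈ s.toRight, MeasurableSet[b j] (t (Sum.inr j)) := fun j hj =>
    ht _ (Finset.mem_toRight.mp hj)
  have hset : ⋂ i ∈ s, t i
      = (⋂ i ∈ s.toLeft, t (Sum.inl i)) ∩ ⋂ j ∈ s.toRight, t (Sum.inr j) := by
    ext ω
    simp only [Set.mem_iInter, Set.mem_inter_iff, Finset.mem_toLeft, Finset.mem_toRight, Sum.forall]
  have hprod : ∏ i ∈ s, μ (t i)
      = (∏ i ∈ s.toLeft, μ (t (Sum.inl i))) * ∏ j ∈ s.toRight, μ (t (Sum.inr j)) := by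
    conv_lhs => rw [← Finset.toLeft_disjSum_toRight (u := s)]
    rw [Finset.prod_disjSum]
  rw [hset, hprod, ← ha.meas_biInter hl, ← hb.meas_biInter hr]
  refine (Indep_iff _ _ μ).mp hab _ _ ?_ ?_
  · exact Finset.measurableSet_biInter _ fun i hi => (le_iSup a i) _ (hl i hi)
  · exact Finset.measurableSet_biInter _ fun j hj => (le_iSup b j) _ (hr j hj)

variable {Ξ : Type*} [MeasurableSpace Ξ] {d : ℕ} {n m : ℕ → ℕ}

/-- The sigma-algebra generated by the samples and directions of the iterations in `S`. -/
abbrev seedSigma (ξ : (k : ℕ) → Fin (n k) → Fin (m k) → Ω → Ξ) (ζ : (k : ℕ) → Fin (n k) → Ω → Vec d)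
    (S : Set ℕ) : MeasurableSpace Ω :=
  ⨆ q ∈ {q : ((k : ℕ) × (Fin (n k) × Fin (m k))) ⊕ ((k : ℕ) × Fin (n k)) |
      Sum.elim Sigma.fst Sigma.fst q ∈ S},
    Sum.elim (fun q => MeasurableSpace.comap (ξ q.1 q.2.1 q.2.2) inferInstance)
      (fun q => MeasurableSpace.comap (ζ q.1 q.2) inferInstance) q

variable {ξ : (k : ℕ) → Fin (n k) → Fin (m k) → Ω → Ξ} {ζ : (k : ℕ) → Fin (n k) → Ω → Vec d}

theorem measurable_sample_seedSigma {S : Set ℕ} {k : ℕ} (hk : k ∈ S) (i : Fin (n k))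
    (j : Fin (m k)) : Measurable[seedSigma ξ ζ S] (ξ k i j) := by
  refine (comap_measurable (ξ k i j)).mono ?_ le_rfl
  exact le_iSup₂_of_le (Sum.inl ⟨k, i, j⟩) hk le_rfl

theorem measurable_direction_seedSigma {S : Set ℕ} {k : ℕ} (hk : k ∈ S) (i : Fin (n k)) :
    Measurable[seedSigma ξ ζ S] (ζ k i) := by
  refine (comap_measurable (ζ k i)).mono ?_ le_rfl
  exact le_iSup₂_of_le (Sum.inr ⟨k, i⟩) hk le_rfl

/-- Samples and directions are merged into one independent family, indexed by a sum type, so that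
disjoint sets of iterations give disjoint index sets. -/
theorem IsSampling.indep_seedSigma {P : Measure Ξ} {Q : Measure (Vec d)}
    (h : IsSampling μ P Q n m ξ ζ) {S S' : Set ℕ} (hS : Disjoint S S') :
    Indep (seedSigma ξ ζ S) (seedSigma ξ ζ S') μ := by
  refine indep_iSup_of_disjoint (fun q => ?_) (iIndep_sumElim h.indep_sample.iIndep
    h.indep_direction.iIndep ?_) ?_
  · rcases q with ⟨k, i, j⟩ | ⟨k, i⟩
    · exact (h.measurable_sample k i j).comap_le
    · exact (h.measurable_direction k i).comap_le
  · refine indep_of_indep_of_le_left (indep_of_indep_of_le_right h.indep ?_) ?_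
    · refine iSup_le fun q => Measurable.comap_le ?_
      exact (measurable_pi_apply q.2).comp ((measurable_pi_apply q.1).comp
        (comap_measurable fun ω k i => ζ k i ω))
    · refine iSup_le fun q => Measurable.comap_le ?_
      exact (measurable_pi_apply q.2.2).comp ((measurable_pi_apply q.2.1).comp
        ((measurable_pi_apply q.1).comp (comap_measurable fun ω k i j => ξ k i j ω)))
  · rw [Set.disjoint_left] at hS ⊢
    exact fun q hq hq' => hS hq hq'

end Independence

/-! ### Measurability of the iterates -/

section Iterates

variable {Ω Ξ : Type*} {d : ℕ} {n m : ℕ → ℕ}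

/-- The averaged direction `m_k` of the accelerated method. -/
noncomputable def direction (f : Vec d → Ξ → ℝ) (γ α : ℕ → ℝ)
    (ξ : (k : ℕ) → Fin (n k) → Fin (m k) → Ω → Ξ) (ζ : (k : ℕ) → Fin (n k) → Ω → Vec d)
    (X : ℕ → Ω → Vec d) (k : ℕ) (ω : Ω) : Vec d :=
  momentum γ α (fun j => step f (α j) (X j ω) (fun i i' => ξ j i i' ω) (fun i => ζ j i ω)) k

variable {f : Vec d → Ξ → ℝ} {γ α : ℕ → ℝ} {ξ : (k : ℕ) → Fin (n k) → Fin (m k) → Ω → Ξ}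
  {ζ : (k : ℕ) → Fin (n k) → Ω → Vec d} {x₁ : Vec d} {X : ℕ → Ω → Vec d}

theorem direction_succ (hγ : ∀ k, 1 ≤ k → 0 < γ k) (k : ℕ) (ω : Ω) :
    direction f γ α ξ ζ X (k + 1) ω
      = (1 - (weightDenom γ k)⁻¹) • direction f γ α ξ ζ X k ω
        + (weightDenom γ k)⁻¹ • (α (k + 1))⁻¹ • step f (α (k + 1)) (X (k + 1) ω)
          (fun i i' => ξ (k + 1) i i' ω) (fun i => ζ (k + 1) i ω) :=
  momentum_succ hγ α _ k

/-- The sigma-algebra on `Ω` is arbitrary and only seeds up to `k` are assumed measurable. Hence the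
lemma also shows that `x_{k+1}` and `m_k` depend on the past seeds alone. -/
theorem measurable_iterates [MeasurableSpace Ω] [MeasurableSpace Ξ]
    (hf : Measurable (Function.uncurry f)) (hγ : ∀ k, 1 ≤ k → 0 < γ k)
    (hX : IsMomentumMethod f γ α ξ ζ x₁ X) (k : ℕ)
    (hξ : ∀ j ≤ k, ∀ i i', Measurable (ξ j i i')) (hζ : ∀ j ≤ k, ∀ i, Measurable (ζ j i)) :
    Measurable (X (k + 1)) ∧ Measurable (direction f γ α ξ ζ X k) := by
  induction k with
  | zero =>
    constructor
    · rw [show X (0 + 1) = fun _ => x₁ from funext hX.start]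
      exact measurable_const
    · rw [show direction f γ α ξ ζ X 0 = fun _ => 0 from funext fun ω => momentum_zero _ _ _]
      exact measurable_const
  | succ k ih =>
    obtain ⟨hx, hv⟩ := ih (fun j hj => hξ j (by omega)) (fun j hj => hζ j (by omega))
    have hs : Measurable fun ω => step f (α (k + 1)) (X (k + 1) ω)
        (fun i i' => ξ (k + 1) i i' ω) (fun i => ζ (k + 1) i ω) :=
      measurable_step hf _ hx
        (measurable_pi_lambda _ fun i => measurable_pi_lambda _ fun j => hξ _ le_rfl i j)
        (measurable_pi_lambda _ fun i => hζ _ le_rfl i)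
    have hv' : Measurable (direction f γ α ξ ζ X (k + 1)) := by
      rw [funext (direction_succ (f := f) (α := α) (ξ := ξ) (ζ := ζ) (X := X) hγ k)]
      exact (hv.const_smul (1 - (weightDenom γ k)⁻¹)).add
        ((hs.const_smul (α (k + 1))⁻¹).const_smul (weightDenom γ k)⁻¹)
    refine ⟨?_, hv'⟩
    rw [show X (k + 1 + 1) = fun ω => X (k + 1) ω + α (k + 1) • direction f γ α ξ ζ X (k + 1) ω
      from funext (hX.next (k + 1) (by omega))]
    exact hx.add (hv'.const_smul (α (k + 1)))

end Iterates

/-! ### The scaled step as an estimator of the negative gradient -/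

section Estimator

variable {Ω Ξ : Type*} [MeasurableSpace Ω] [MeasurableSpace Ξ] {d : ℕ} {n m : ℕ → ℕ}
  {μ : Measure Ω} [IsProbabilityMeasure μ] {P : Measure Ξ}
  {Q : Measure (Vec d)} [IsProbabilityMeasure Q]
  {f : Vec d → Ξ → ℝ} {γ α : ℕ → ℝ} {ξ : (k : ℕ) → Fin (n k) → Fin (m k) → Ω → Ξ}
  {ζ : (k : ℕ) → Fin (n k) → Ω → Vec d} {x₁ : Vec d} {X : ℕ → Ω → Vec d} {L M MV : ℝ}

/-- In iteration `k + 1` the scaled step estimates the negative gradient, with a bias of order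
`α`, given the history of the method. -/
theorem isEstimator_step (hf : Measurable (Function.uncurry f)) (hfint : ∀ x, Integrable (f x) P)
    (hF : HasLipschitzGradient (objective P f) L) (hQ : IsDirectionLaw Q)
    (hn : ∀ k, 0 < n k) (hm : ∀ k, 0 < m k) (hsample : IsSampling μ P Q n m ξ ζ)
    (hα : ∀ k, 0 < α k) (hγ : ∀ k, 1 ≤ k → 0 < γ k) (hX : IsMomentumMethod f γ α ξ ζ x₁ X)
    (hvar : HasStepVarianceBound μ P f α ξ ζ X M MV) (k : ℕ) :
    -- The state includes `m_k`, since the step is later paired with the momentum as well as with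
    -- the gradient.
    IsEstimator μ (fun ω => (X (k + 1) ω, direction f γ α ξ ζ X k ω))
      (fun ω => ((fun i j => ξ (k + 1) i j ω : Fin (n (k + 1)) → Fin (m (k + 1)) → Ξ),
        (fun i => ζ (k + 1) i ω : Fin (n (k + 1)) → Vec d)))
      (fun z w => (α (k + 1))⁻¹ • step f (α (k + 1)) z.1 w.1 w.2)
      (fun z => gradient (objective P f) z.1) M MV
      (L / 2 * (∫ u : Vec d, ‖u‖ ^ 3 ∂Q) * α (k + 1)) := by
  have hα' := hα (k + 1)
  obtain ⟨hx, hv⟩ := measurable_iterates hf hγ hX k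
    (fun j _ => hsample.measurable_sample j) (fun j _ => hsample.measurable_direction j)
  refine ⟨hx.prodMk hv, ?_, ?_, ?_, ?_, ?_, ?_, ?_⟩
  · exact (measurable_pi_lambda _ fun i => measurable_pi_lambda _ fun j =>
      hsample.measurable_sample _ i j).prodMk
      (measurable_pi_lambda _ fun i => hsample.measurable_direction _ i)
  · have hdisj : Disjoint (Set.Iic k) {k + 1} := by simp
    have hmem : k + 1 ∈ ({k + 1} : Set ℕ) := rfl
    refine indep_of_indep_of_le_left (indep_of_indep_of_le_right
      (hsample.indep_seedSigma hdisj) ?_) ?_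
    · refine Measurable.comap_le ?_
      have h1 : Measurable[seedSigma ξ ζ {k + 1}] fun ω i j => ξ (k + 1) i j ω :=
        @measurable_pi_lambda _ _ _ (seedSigma ξ ζ {k + 1}) _ _ fun i =>
          @measurable_pi_lambda _ _ _ (seedSigma ξ ζ {k + 1}) _ _ fun j =>
            measurable_sample_seedSigma hmem i j
      have h2 : Measurable[seedSigma ξ ζ {k + 1}] fun ω i => ζ (k + 1) i ω :=
        @measurable_pi_lambda _ _ _ (seedSigma ξ ζ {k + 1}) _ _ fun i =>
          measurable_direction_seedSigma hmem i
      exact h1.prodMk h2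
    · have h1 : ∀ j ≤ k, ∀ i i', Measurable[seedSigma ξ ζ (Set.Iic k)] (ξ j i i') :=
        fun j hj i i' => measurable_sample_seedSigma (Set.mem_Iic.mpr hj) i i'
      have h2 : ∀ j ≤ k, ∀ i, Measurable[seedSigma ξ ζ (Set.Iic k)] (ζ j i) :=
        fun j hj i => measurable_direction_seedSigma (Set.mem_Iic.mpr hj) i
      -- Measurability for the sigma-algebra of the seeds up to `k`, which is independent of the
      -- seeds of iteration `k + 1`.
      obtain ⟨hx', hv'⟩ := @measurable_iterates Ω Ξ d n m f γ α ξ ζ x₁ X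
        (seedSigma ξ ζ (Set.Iic k)) _ hf hγ hX k h1 h2
      exact Measurable.comap_le (hx'.prodMk hv')
  · have hs : Measurable fun q : (Vec d × Vec d) ×
        ((Fin (n (k + 1)) → Fin (m (k + 1)) → Ξ) × (Fin (n (k + 1)) → Vec d)) =>
        step f (α (k + 1)) q.1.1 q.2.1 q.2.2 :=
      measurable_step hf _ (measurable_fst.comp measurable_fst)
        (measurable_fst.comp measurable_snd) (measurable_snd.comp measurable_snd)
    exact hs.const_smul (α (k + 1))⁻¹
  · exact hF.continuous_gradient.measurable.comp measurable_fst
  · filter_upwards [hvar (k + 1) (by omega)] with ω hω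
    exact hω.1.const_smul (α (k + 1))⁻¹
  · filter_upwards [hvar (k + 1) (by omega)] with ω hω
    have h2 := hω.2
    simp only [norm_smul, mul_pow, integral_smul, integral_const_mul, norm_inv,
      Real.norm_of_nonneg hα'.le]
    rw [← mul_sub, inv_pow, inv_mul_le_iff₀ (by positivity)]
    linarith
  · filter_upwards [hvar (k + 1) (by omega)] with ω hω
    have hind : IndepFun (fun ω i j => ξ (k + 1) i j ω) (fun ω i => ζ (k + 1) i ω) μ :=
      hsample.indep.comp (measurable_pi_apply (k + 1)) (measurable_pi_apply (k + 1))
    have h1 := integral_step hf hfint hF hQ (hn (k + 1)) (hm (k + 1))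
      (hsample.measurable_sample (k + 1)) (hsample.measurable_direction (k + 1))
      (hsample.law_sample (k + 1)) (hsample.law_direction (k + 1)) hind (α (k + 1))
      (X (k + 1) ω) (hω.1.integrable one_le_two)
    have h2 := norm_integral_diff_smul_add_le hQ hF (α (k + 1)) (X (k + 1) ω)
    rw [← h1] at h2
    rw [integral_smul]
    have h3 : ∀ s g : Vec d, (α (k + 1))⁻¹ • s + g = (α (k + 1))⁻¹ • (s + α (k + 1) • g) :=
      fun s g => by rw [smul_add, smul_smul, inv_mul_cancel₀ hα'.ne', one_smul]
    rw [h3, norm_smul, norm_inv, Real.norm_of_nonneg hα'.le, inv_mul_le_iff₀ hα']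
    linarith

end Estimator

end SGFD

/-! ### Assembly of the convergence theorem -/

theorem mainTheorem6 {Ω Ξ : Type*} [MeasurableSpace Ω] [MeasurableSpace Ξ] {d : ℕ}
    (μ : Measure Ω) [IsProbabilityMeasure μ]
    (P : Measure Ξ) [IsProbabilityMeasure P]
    (Q : Measure (SGFD.Vec d)) [IsProbabilityMeasure Q]
    (f : SGFD.Vec d → Ξ → ℝ) (hf : Measurable (Function.uncurry f))
    (hfint : ∀ x, Integrable (f x) P)
    (L : ℝ) (hL : 0 < L) (hLip : SGFD.HasLipschitzGradient (SGFD.objective P f) L)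
    (hgen : SGFD.IsGeneralObjective (SGFD.objective P f))
    (hQ : SGFD.IsDirectionLaw Q)
    (n m : ℕ → ℕ) (hn : ∀ k, 0 < n k) (hm : ∀ k, 0 < m k)
    (ξ : (k : ℕ) → Fin (n k) → Fin (m k) → Ω → Ξ)
    (ζ : (k : ℕ) → Fin (n k) → Ω → SGFD.Vec d)
    (hsample : SGFD.IsSampling μ P Q n m ξ ζ)
    (β σ : ℝ) (hβ : 0 < β) (hσ : 0 < σ)
    (γ : ℕ → ℝ) (hγ : SGFD.IsDecayFactor γ)
    (x₁ : SGFD.Vec d) (X : ℕ → Ω → SGFD.Vec d)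
    (hX : SGFD.IsMomentumMethod f γ (SGFD.stepsize β σ) ξ ζ x₁ X)
    (M MV : ℝ) (hM : 0 ≤ M) (hMV : 0 ≤ MV)
    (hvar : SGFD.HasStepVarianceBound μ P f (SGFD.stepsize β σ) ξ ζ X M MV) :
    (∀ k, 1 ≤ k → Integrable (fun ω => ‖gradient (SGFD.objective P f) (X k ω)‖ ^ 2) μ) ∧
      Tendsto (fun k => ∫ ω, ‖gradient (SGFD.objective P f) (X k ω)‖ ^ 2 ∂μ) atTop (𝓝 0) := by
  have hα := SGFD.stepsize_pos hβ hσ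
  have hγ0 := hγ.pos
  have hest := SGFD.isEstimator_step hf hfint hLip hQ hn hm hsample hα hγ0 hX hvar
  set F := SGFD.objective P f with hFdef
  set α := SGFD.stepsize β σ with hαdef
  set C := L / 2 * ∫ u : SGFD.Vec d, ‖u‖ ^ 3 ∂Q with hCdef
  have hC : 0 ≤ C := mul_nonneg (by positivity) (integral_nonneg fun _ => by positivity)
  set V := SGFD.direction f γ α ξ ζ X with hVdef
  set T : ℕ → Ω → SGFD.Vec d := fun k ω => (α (k + 1))⁻¹ • SGFD.step f (α (k + 1)) (X (k + 1) ω)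
    (fun i i' => ξ (k + 1) i i' ω) (fun i => ζ (k + 1) i ω) with hTdef
  have hVsucc : ∀ k ω, V (k + 1) ω = (1 - (SGFD.weightDenom γ k)⁻¹) • V k ω
      + (SGFD.weightDenom γ k)⁻¹ • T k ω := SGFD.direction_succ hγ0
  have hXsucc : ∀ k ω, X (k + 1 + 1) ω = X (k + 1) ω + α (k + 1) • V (k + 1) ω := fun k ω =>
    hX.next (k + 1) (by omega) ω
  have hTmem : ∀ k, MemLp (X (k + 1)) 2 μ → MemLp (T k) 2 μ := fun k hx =>
    (hest k).memLp_comp (hLip.memLp_gradient hx)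
  -- Square integrability propagates jointly: `∇F` grows at most linearly, so `x_{k+1}` in `L²` puts
  -- the next step, hence `m_{k+1}` and `x_{k+2}`, in `L²`.
  have hmem : ∀ k, MemLp (X (k + 1)) 2 μ ∧ MemLp (V k) 2 μ := fun k => by
    induction k with
    | zero =>
      rw [show X (0 + 1) = fun _ => x₁ from funext hX.start,
        show V 0 = fun _ => 0 from funext fun ω => SGFD.momentum_zero _ _ _]
      exact ⟨memLp_const _, memLp_const _⟩
    | succ k ih =>
      have hv : MemLp (V (k + 1)) 2 μ := by
        rw [funext (hVsucc k)]
        exact (ih.2.const_smul (1 - (SGFD.weightDenom γ k)⁻¹)).add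
          ((hTmem k ih.1).const_smul (SGFD.weightDenom γ k)⁻¹)
      refine ⟨?_, hv⟩
      rw [funext (hXsucc k)]
      exact ih.1.add (hv.const_smul (α (k + 1)))
  have hgmem := fun k => hLip.memLp_gradient (hmem k).1
  obtain ⟨b, hb⟩ := hgen.bddBelow
  have hD1 := SGFD.one_le_weightDenom hγ0
  -- Index `k` of the recursion is iteration `k + 1`, with initial momentum zero. `A` and `B` come
  -- from `integral_norm_sq_le`, with the bias `C α` bounded by `C β / σ`.
  have hrec := SGFD.momentRecursion_of_estimates (C := C) (A := M + 2 * (C * (β / σ)) ^ 2)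
    (B := MV + 2) (b := b) (α := fun k => α (k + 1)) (θ := fun k => (SGFD.weightDenom γ k)⁻¹)
    (X := fun k => X (k + 1)) (V := V) (T := T) hLip hL hb (fun k => (hα _).le)
    (fun k => inv_nonneg.mpr (zero_le_one.trans (hD1 k))) (fun k => inv_le_one_of_one_le₀ (hD1 k))
    (fun k => (hmem k).1) (fun k => (hmem k).2) (fun k => hTmem k (hmem k).1) hVsucc hXsucc
    (fun k => by
      have h1 := (hest k).integral_inner_le (mul_nonneg hC (hα _).le) (hgmem k)
        (φ := fun z => gradient F z.1) (hest k).measurable_grad (hgmem k)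
      simpa only [real_inner_self_eq_norm_sq] using h1)
    (fun k => by
      have h1 := (hest k).integral_inner_le (mul_nonneg hC (hα _).le) (hgmem k)
        (φ := fun z => z.2) measurable_snd (hmem k).2
      simpa only [real_inner_comm] using h1)
    (fun k => by
      refine ((hest k).integral_norm_sq_le hM hMV (hgmem k)).trans ?_
      have h1 : C * α (k + 1) ≤ C * (β / σ) := by
        gcongr
        exact SGFD.stepsize_le hβ hσ _
      have h2 := pow_le_pow_left₀ (mul_nonneg hC (hα (k + 1)).le) h1 2
      linarith)
  refine ⟨fun k hk => ?_, ?_⟩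
  · obtain ⟨k, rfl⟩ := Nat.exists_eq_add_of_le' hk
    exact (hgmem k).integrable_norm_pow two_ne_zero
  · rw [← tendsto_add_atTop_iff_nat 1]
    exact hrec.tendsto_of_isDecayFactor hβ hσ hL hC (by positivity) (by positivity) hγ
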